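/- Let $N\ge 3$, $2<q<2+\frac4N$, $\mu>0$, $2^*=\frac{2N}{N-2}$, $H=H^1(\mathbb R^N,\mathbb C)$. Let $\mathcal S>0$ be the optimal (largest) constant in the Sobolev inequality $\mathcal S\|f\|_{2^*}^2\le\|\nabla f\|_2^2$ $(f\in H)$, and let $C=C_{N,q}$ be any constant for which the Gagliardo–Nirenberg inequality $\|f\|_q\le C\,\|\nabla f\|_2^{\beta}\|f\|_2^{1-\beta}$, $\beta=N\left(\frac12-\frac1q\right)$, holds for all $f\in H$. Put $$\alpha_0=\tfrac{N(q-2)}2-2,\quad \alpha_1=\tfrac{2N-q(N-2)}2,\quad \alpha_2=\tfrac4{N-2},\quad A=-\frac{\alpha_0}{\alpha_2}\,\frac{\mu\,C^q\,2^*\,\mathcal S^{2^*/2}}{q},$$ $$K=\frac{\mu}{q}C^q A^{\frac{\alpha_0}{\alpha_2-\alpha_0}}+\frac1{2^*}\frac1{\mathcal S^{2^*/2}}A^{\frac{\alpha_2}{\alpha_2-\alpha_0}},\qquad c_0=\Big(\frac1{2K}\Big)^{N/2},\qquad \rho_0=A^{\frac2{\alpha_2-\alpha_0}}c_0^{\frac{\alpha_1}{\alpha_2-\alpha_0}}.$$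 For $u\in H$ let $$F_\mu(u)=\tfrac12\|\nabla u\|_2^2-\tfrac{\mu}{q}\|u\|_q^q-\tfrac1{2^*}\|u\|_{2^*}^{2^*},$$ and let $B_{\rho_0}=\{u\in H:\|\nabla u\|_2^2<\rho_0\}$. For $c\in(0,c_0)$ let $$V(c)=\{u\in B_{\rho_0}:\|u\|_2^2=c\},\qquad m(c)=\inf_{V(c)}F_\mu,\qquad \mathcal M_c=\{u\in V(c):F_\mu(u)=m(c)\}.$$ Then, for every $c\in(0,c_0)$: if $(u_n)\subset B_{\rho_0}$ satisfies $\|u_n\|_2^2\to c$ and $F_\mu(u_n)\to m(c)$, then there are a subsequence $(u_{n_k})$, points $y_k\in\mathbb R^N$ and an element $u\in\mathcal M_c$ such that $u_{n_k}(\cdot-y_k)\to u$ strongly in $H$. In particular, $\mathcal M_c$ is nonempty, and it is compact in $H$ up to translation: every sequence $(v_n)\subset\mathcal M_c$ has a subsequence $(v_{n_k})$ such that, for suitable $y_k\in\mathbb R^N$, $v_{n_k}(\cdot-y_k)$ converges in $H$ to an element of $\mathcal M_c$. -/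

import Mathlib

open MeasureTheory Filter Topology Set
open scoped ENNReal ContDiff

noncomputable section

namespace MixedNLS

/-- `ℝ^N` with its Euclidean norm. -/
abbrev Eucl (N : ℕ) : Type := EuclideanSpace ℝ (Fin N)

/-- `L²(ℝ^N, ℂ)`. -/
abbrev L2 (N : ℕ) : Type := Lp ℂ 2 (volume : Measure (Eucl N))

/-- `L²(ℝ^N, ℂ^N)`. -/
abbrev L2Vec (N : ℕ) : Type := Lp (EuclideanSpace ℂ (Fin N)) 2 (volume : Measure (Eucl N))

/-- `g` is the weak (distributional) gradient of `u`:
`∫ u ∂ᵢφ = - ∫ gᵢ φ` for every `φ ∈ C_c^∞(ℝ^N)` and every `i`. -/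
def IsWeakGradient {N : ℕ} (u : Eucl N → ℂ) (g : Eucl N → EuclideanSpace ℂ (Fin N)) : Prop :=
  ∀ φ : Eucl N → ℝ, ContDiff ℝ ∞ φ → HasCompactSupport φ → ∀ i : Fin N,
    ∫ x, (fderiv ℝ φ x (EuclideanSpace.single i 1)) • u x = - ∫ x, φ x • (g x) i

theorem IsWeakGradient.congr {N : ℕ} {u u' : Eucl N → ℂ}
    {g g' : Eucl N → EuclideanSpace ℂ (Fin N)} (h : IsWeakGradient u g)
    (hu : u =ᵐ[volume] u') (hg : g =ᵐ[volume] g') : IsWeakGradient u' g' := by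
  intro φ hφ hc i
  have h1 : ∫ x, (fderiv ℝ φ x (EuclideanSpace.single i 1)) • u x
      = ∫ x, (fderiv ℝ φ x (EuclideanSpace.single i 1)) • u' x :=
    integral_congr_ae (hu.mono fun x hx => by simp only [hx])
  have h2 : ∫ x, φ x • (g x) i = ∫ x, φ x • (g' x) i :=
    integral_congr_ae (hg.mono fun x hx => by simp only [hx])
  rw [← h1, ← h2]
  exact h φ hφ hc i

theorem integrable_deriv_smul {N : ℕ} (u : L2 N) {φ : Eucl N → ℝ} (hφ : ContDiff ℝ ∞ φ)
    (hc : HasCompactSupport φ) (e : Eucl N) :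
    Integrable (fun x => (fderiv ℝ φ x e) • u x) := by
  refine ((Lp.memLp u).locallyIntegrable (by norm_num)).integrable_smul_left_of_hasCompactSupport
    ?_ (hc.fderiv_apply (𝕜 := ℝ) e)
  exact (hφ.continuous_fderiv (by simp)).clm_apply continuous_const

theorem integrable_smul_coord {N : ℕ} (g : L2Vec N) {φ : Eucl N → ℝ} (hφ : ContDiff ℝ ∞ φ)
    (hc : HasCompactSupport φ) (i : Fin N) :
    Integrable (fun x => φ x • (g x) i) := by
  have h := ((Lp.memLp g).locallyIntegrable
    (by norm_num)).integrable_smul_left_of_hasCompactSupport hφ.continuous hc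
  exact ((EuclideanSpace.proj i : EuclideanSpace ℂ (Fin N) →L[ℂ] ℂ).restrictScalars ℝ).integrable_comp h

/-- The Sobolev space `H = H¹(ℝ^N, ℂ)`, with the Hilbert norm
`‖u‖_H² = ‖u‖₂² + ‖∇u‖₂²`: the pairs `(u, ∇u)` with `u ∈ L²` whose weak gradient `∇u` is in `L²`
(the second component is determined by the first one). -/
def H1 (N : ℕ) : Submodule ℂ (WithLp 2 (L2 N × L2Vec N)) where
  carrier := {p | IsWeakGradient p.fst p.snd}
  zero_mem' := by
    have h : IsWeakGradient (fun _ : Eucl N => (0 : ℂ)) (fun _ => 0) := by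
      intro φ _ _ i
      simp
    exact h.congr (Lp.coeFn_zero _ _ _).symm (Lp.coeFn_zero _ _ _).symm
  add_mem' := by
    intro a b ha hb
    have h : IsWeakGradient (fun x => a.fst x + b.fst x) (fun x => a.snd x + b.snd x) := by
      intro φ hφ hc i
      simp only [smul_add, PiLp.add_apply]
      rw [integral_add (integrable_deriv_smul _ hφ hc _) (integrable_deriv_smul _ hφ hc _),
        integral_add (integrable_smul_coord _ hφ hc _) (integrable_smul_coord _ hφ hc _),
        ha φ hφ hc i, hb φ hφ hc i, neg_add]
    exact h.congr (Lp.coeFn_add _ _).symm (Lp.coeFn_add _ _).symm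
  smul_mem' := by
    intro z a ha
    have h : IsWeakGradient (fun x => z • a.fst x) (fun x => z • a.snd x) := by
      intro φ hφ hc i
      simp only [PiLp.smul_apply, smul_comm _ z]
      rw [integral_smul, integral_smul, ha φ hφ hc i, smul_neg]
    exact h.congr (Lp.coeFn_smul z a.fst).symm (Lp.coeFn_smul z a.snd).symm

/-- The function underlying an element of `H`. -/
def fn {N : ℕ} (u : H1 N) : L2 N := (u : WithLp 2 (L2 N × L2Vec N)).fst

/-- The weak gradient of an element of `H`. -/
def grad {N : ℕ} (u : H1 N) : L2Vec N := (u : WithLp 2 (L2 N × L2Vec N)).snd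

/-- The norm `‖u‖_p` of `u ∈ H` in `L^p(ℝ^N)`, for a real exponent `p`. -/
def normLp {N : ℕ} (p : ℝ) (u : H1 N) : ℝ := lpNorm (fn u) (ENNReal.ofReal p) volume

/-- The norm `‖∇u‖₂`. -/
def gradNorm {N : ℕ} (u : H1 N) : ℝ := ‖grad u‖

theorem IsWeakGradient.translate {N : ℕ} {u : Eucl N → ℂ}
    {g : Eucl N → EuclideanSpace ℂ (Fin N)} (h : IsWeakGradient u g) (y : Eucl N) :
    IsWeakGradient (fun x => u (x - y)) (fun x => g (x - y)) := by
  intro φ hφ hc i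
  have h' := h (fun x => φ (x + y)) (hφ.comp (contDiff_id.add contDiff_const))
    (hc.comp_homeomorph (Homeomorph.addRight y)) i
  simp only [fderiv_comp_add_right] at h'
  rw [← integral_sub_right_eq_self (fun x => fderiv ℝ φ (x + y) _ • u x) y,
    ← integral_sub_right_eq_self (fun x => φ (x + y) • (g x) i) y] at h'
  simpa only [sub_add_cancel] using h'

/-- The translation `u ↦ u(· - y)` on `H`. -/
def shift {N : ℕ} (y : Eucl N) (u : H1 N) : H1 N :=
  ⟨WithLp.toLp 2
    (Lp.compMeasurePreserving (fun x => x - y) (measurePreserving_sub_right volume y) (fn u),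
      Lp.compMeasurePreserving (fun x => x - y) (measurePreserving_sub_right volume y) (grad u)),
    (IsWeakGradient.translate u.2 y).congr
      (Lp.coeFn_compMeasurePreserving _ _).symm (Lp.coeFn_compMeasurePreserving _ _).symm⟩

/-- A set `A ⊆ H` is compact up to translation: every sequence in `A` has a subsequence which,
after translating each of its terms, converges in `H` to an element of `A`. -/
def IsCompactUpToTranslation {N : ℕ} (A : Set (H1 N)) : Prop :=
  ∀ u : ℕ → H1 N, (∀ n, u n ∈ A) →
    ∃ k : ℕ → ℕ, StrictMono k ∧ ∃ y : ℕ → Eucl N, ∃ v ∈ A,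
      Tendsto (fun n => shift (y n) (u (k n))) atTop (𝓝 v)

/-- The critical Sobolev exponent `2^* = 2N/(N-2)`. -/
def critExp (N : ℕ) : ℝ := 2 * N / (N - 2)

/-- The optimal constant `S` of the Sobolev inequality `S ‖f‖_{2^*}² ≤ ‖∇f‖₂²`, `f ∈ H`. -/
def sobolevConst (N : ℕ) : ℝ :=
  sSup {S : ℝ | ∀ f : H1 N, S * normLp (critExp N) f ^ 2 ≤ gradNorm f ^ 2}

/-- The optimal constant `C` of the Gagliardo-Nirenberg inequality
`‖f‖_p ≤ C ‖∇f‖₂^β ‖f‖₂^(1-β)`, `f ∈ H`, where `β = N (1/2 - 1/p)`. -/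
def gnConst (N : ℕ) (p : ℝ) : ℝ :=
  sInf {C : ℝ | 0 ≤ C ∧ ∀ f : H1 N, normLp p f ≤
    C * gradNorm f ^ (N * (1 / 2 - 1 / p) : ℝ) * normLp 2 f ^ (1 - N * (1 / 2 - 1 / p) : ℝ)}

def alpha0 (N : ℕ) (q : ℝ) : ℝ := N * (q - 2) / 2 - 2

def alpha1 (N : ℕ) (q : ℝ) : ℝ := (2 * N - q * (N - 2)) / 2

def alpha2 (N : ℕ) : ℝ := 4 / (N - 2)

/-- The quantity `-(α₀/α₂) μ C^q 2^* S^(2^*/2) / q`. -/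
def bracket (N : ℕ) (q μ C : ℝ) : ℝ :=
  -(alpha0 N q / alpha2 N) * (μ * C ^ q * critExp N * sobolevConst N ^ (critExp N / 2) / q)

/-- The constant `K`. -/
def constK (N : ℕ) (q μ C : ℝ) : ℝ :=
  μ / q * C ^ q * bracket N q μ C ^ (alpha0 N q / (alpha2 N - alpha0 N q))
    + 1 / critExp N * (1 / sobolevConst N ^ (critExp N / 2))
      * bracket N q μ C ^ (alpha2 N / (alpha2 N - alpha0 N q))

/-- The mass threshold `c₀ = (1/(2K))^(N/2)`. -/
def c0 (N : ℕ) (q μ C : ℝ) : ℝ := (1 / (2 * constK N q μ C)) ^ (N / 2 : ℝ)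

/-- `ρ_c`, the maximum point of
`ρ ↦ 1/2 - (μ/q) C^q ρ^(α₀/2) c^(α₁/2) - (1/2^*) S^(-2^*/2) ρ^(α₂/2)` on `(0, ∞)`. -/
def rhoAt (N : ℕ) (q μ C c : ℝ) : ℝ :=
  bracket N q μ C ^ (2 / (alpha2 N - alpha0 N q))
    * c ^ (alpha1 N q / (alpha2 N - alpha0 N q))

/-- `ρ₀ = ρ_{c₀}`. -/
def rho0 (N : ℕ) (q μ C : ℝ) : ℝ := rhoAt N q μ C (c0 N q μ C)

/-- The energy `F_μ(u) = (1/2) ‖∇u‖₂² - (μ/q) ‖u‖_q^q - (1/2^*) ‖u‖_{2^*}^{2^*}`. -/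
def energy {N : ℕ} (q μ : ℝ) (u : H1 N) : ℝ :=
  1 / 2 * gradNorm u ^ 2 - μ / q * normLp q u ^ q
    - 1 / critExp N * normLp (critExp N) u ^ critExp N

/-- The mass constraint `S(c) = {u ∈ H : ‖u‖₂² = c}`. -/
def massSphere (N : ℕ) (c : ℝ) : Set (H1 N) := {u | normLp 2 u ^ 2 = c}

/-- `B_ρ = {u ∈ H : ‖∇u‖₂² < ρ}`. -/
def gradBall (N : ℕ) (ρ : ℝ) : Set (H1 N) := {u | gradNorm u ^ 2 < ρ}

/-- `V(c) = S(c) ∩ B_{ρ₀}`. -/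
def localSet (N : ℕ) (q μ C c : ℝ) : Set (H1 N) := massSphere N c ∩ gradBall N (rho0 N q μ C)

/-- `m(c) = inf_{V(c)} F_μ`. -/
def infEnergy (N : ℕ) (q μ C c : ℝ) : ℝ := sInf (energy q μ '' localSet N q μ C c)

/-- `M_c = {u ∈ V(c) : F_μ(u) = m(c)}`. -/
def minimizers (N : ℕ) (q μ C c : ℝ) : Set (H1 N) :=
  {u | u ∈ localSet N q μ C c ∧ energy q μ u = infEnergy N q μ C c}

end MixedNLS

end

open MixedNLS

namespace MixedNLS

/-! On `B_{ρ₀}` the critical power behaves like a perturbation of the Dirichlet term. The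
Gagliardo–Nirenberg and Sobolev inequalities give `F_μ(u) ≥ ‖∇u‖² f(‖u‖₂², ‖∇u‖²)`, where `f(c, ρ) =
1/2 - (μ/q) C^q ρ^(α₀/2) c^(α₁/2) - (1/2^*) S^(-2^*/2) ρ^(α₂/2)`, and `c₀`, `ρ₀` are chosen so that
`f(c₀, ρ₀) = 0` (`threshold_eq`). Hence the energy is nonnegative on the boundary sphere for masses
below `c₀`, and `1/2 - (1/2^*) S^(-2^*/2) ρ₀^(α₂/2)` is a positive coercivity constant inside. Since
`q` is mass-subcritical, spreading out a fixed profile gives `m(c) < 0` (`infEnergy_neg`).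

Vanishing is excluded because negative energy keeps `‖u_n‖_q` away from zero: some mollification is
then large at a point (`exists_moll_ge`), and translating that point to the origin yields a nonzero
weak limit `v`. Local compactness gives almost everywhere convergence along a subsequence, and the
Brezis–Lieb lemma splits mass, Dirichlet energy and full energy between `v` and the remainder `w_n`
(`tendsto_splitting`).

Dichotomy is excluded by `infEnergy_mul_le`: in the closed gradient ball a function of mass `m ∈ (0,
c]` has energy at least `(m/c) m(c)`, strictly more if `m < c`. Added over `v` and `w_n` this
contradicts minimality unless `v` carries all the mass. The mass of `w_n` then tends to zero, so its
subcritical term does too, and coercivity forces `∇w_n → 0` in `L²`. Convergence is therefore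
strong. Finally `v` is not on the boundary sphere, where the energy is nonnegative while `m(c) < 0`.
-/

/-! ### Mollification and the L² modulus of continuity of Sobolev functions. -/

/-- Minkowski's inequality for averages over a probability measure. -/
theorem eLpNorm_integral_le {X Y E : Type*} [MeasurableSpace X] [MeasurableSpace Y]
    [NormedAddCommGroup E] [NormedSpace ℝ E] {μ : Measure X} {ν : Measure Y} [SFinite μ]
    [IsProbabilityMeasure ν] {p : ℝ≥0∞} (hp : 1 ≤ p) (hp' : p ≠ ⊤) {K : X → Y → E}
    (hK : StronglyMeasurable (Function.uncurry K)) {M : ℝ≥0∞}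
    (h : ∀ᵐ y ∂ν, eLpNorm (fun x => K x y) p μ ≤ M) :
    eLpNorm (fun x => ∫ y, K x y ∂ν) p μ ≤ M := by
  have hp0 : p ≠ 0 := (zero_lt_one.trans_le hp).ne'
  have hr : 0 < p.toReal := ENNReal.toReal_pos hp0 hp'
  have hm : Measurable fun z : X × Y => ‖K z.1 z.2‖ₑ ^ p.toReal := hK.enorm.pow_const _
  rw [eLpNorm_eq_lintegral_rpow_enorm_toReal hp0 hp', one_div, ENNReal.rpow_inv_le_iff hr]
  calc ∫⁻ x, ‖∫ y, K x y ∂ν‖ₑ ^ p.toReal ∂μ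
      ≤ ∫⁻ x, ∫⁻ y, ‖K x y‖ₑ ^ p.toReal ∂ν ∂μ := by
        refine lintegral_mono fun x => ?_
        have h1 : ‖∫ y, K x y ∂ν‖ₑ ≤ eLpNorm (K x) 1 ν := by
          rw [eLpNorm_one_eq_lintegral_enorm]
          exact enorm_integral_le_lintegral_enorm _
        -- Jensen's inequality, in the form that `L^p` norms increase with `p` on a probability
        -- space.
        have h2 := h1.trans (eLpNorm_le_eLpNorm_of_exponent_le hp
          (hK.comp_measurable measurable_prodMk_left).aestronglyMeasurable)
        rw [eLpNorm_eq_lintegral_rpow_enorm_toReal hp0 hp', one_div,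
          ENNReal.le_rpow_inv_iff hr] at h2
        exact h2
    _ = ∫⁻ y, ∫⁻ x, ‖K x y‖ₑ ^ p.toReal ∂μ ∂ν := lintegral_lintegral_swap hm.aemeasurable
    _ ≤ ∫⁻ _, M ^ p.toReal ∂ν := by
        refine lintegral_mono_ae (h.mono fun y hy => ?_)
        rwa [eLpNorm_eq_lintegral_rpow_enorm_toReal hp0 hp', one_div,
          ENNReal.rpow_inv_le_iff hr] at hy
    _ = M ^ p.toReal := by simp

theorem eLpNorm_comp_sub_right {N : ℕ} {E : Type*} [NormedAddCommGroup E] {p : ℝ≥0∞} (u : Eucl N → E)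
    (hu : AEStronglyMeasurable u volume) (y : Eucl N) :
    eLpNorm (fun x => u (x - y)) p volume = eLpNorm u p volume :=
  eLpNorm_comp_measurePreserving hu (measurePreserving_sub_right volume y)

section Mollifier

variable {N : ℕ} {E : Type*} [NormedAddCommGroup E] [NormedSpace ℝ E]

/-- The probability measure with density a normalized bump function. -/
noncomputable def bumpMeasure (φ : ContDiffBump (0 : Eucl N)) : Measure (Eucl N) :=
  volume.withDensity fun x => ENNReal.ofReal (φ.normed volume x)

theorem measurable_ofReal_normed (φ : ContDiffBump (0 : Eucl N)) :
    Measurable fun x => ENNReal.ofReal (φ.normed volume x) :=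
  φ.continuous_normed.measurable.ennreal_ofReal

instance (φ : ContDiffBump (0 : Eucl N)) : IsProbabilityMeasure (bumpMeasure φ) := by
  constructor
  rw [bumpMeasure, withDensity_apply _ MeasurableSet.univ, setLIntegral_univ,
    ← ofReal_integral_eq_lintegral_ofReal φ.integrable_normed
      (Eventually.of_forall φ.nonneg_normed), φ.integral_normed, ENNReal.ofReal_one]

theorem integral_bumpMeasure (φ : ContDiffBump (0 : Eucl N)) (f : Eucl N → E) :
    ∫ t, f t ∂bumpMeasure φ = ∫ t, φ.normed volume t • f t := by
  rw [bumpMeasure, integral_withDensity_eq_integral_toReal_smul (measurable_ofReal_normed φ)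
    (Eventually.of_forall fun x => ENNReal.ofReal_lt_top)]
  simp only [ENNReal.toReal_ofReal (φ.nonneg_normed _)]

theorem ae_bumpMeasure_norm_le (φ : ContDiffBump (0 : Eucl N)) :
    ∀ᵐ t ∂bumpMeasure φ, ‖t‖ ≤ φ.rOut := by
  rw [bumpMeasure, ae_withDensity_iff (measurable_ofReal_normed φ)]
  refine Eventually.of_forall fun t ht => ?_
  have : t ∈ Function.support (φ.normed volume) := fun h => ht (by simp [h])
  rw [φ.support_normed_eq] at this
  exact (mem_ball_zero_iff.1 this).le

/-- The mollification of `u` by a normalized bump function. -/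
noncomputable def moll (φ : ContDiffBump (0 : Eucl N)) (u : Eucl N → E) : Eucl N → E :=
  convolution (φ.normed volume) u (ContinuousLinearMap.lsmul ℝ ℝ) volume

theorem moll_apply (φ : ContDiffBump (0 : Eucl N)) (u : Eucl N → E) (x : Eucl N) :
    moll φ u x = ∫ t, φ.normed volume t • u (x - t) := rfl

/-- Viewing a mollification as an average of translates over a probability measure makes Minkowski's
inequality applicable with constant one. -/
theorem moll_eq_integral_bumpMeasure (φ : ContDiffBump (0 : Eucl N)) (u : Eucl N → E)
    (x : Eucl N) : moll φ u x = ∫ t, u (x - t) ∂bumpMeasure φ := by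
  rw [integral_bumpMeasure]; rfl

theorem moll_apply_swap (φ : ContDiffBump (0 : Eucl N)) (u : Eucl N → E) (x : Eucl N) :
    moll φ u x = ∫ t, φ.normed volume (x - t) • u t := by
  rw [moll, convolution_eq_swap]; rfl

theorem eLpNorm_moll_le (φ : ContDiffBump (0 : Eucl N)) {u : Eucl N → E}
    (hu : StronglyMeasurable u) {p : ℝ≥0∞} (hp : 1 ≤ p) (hp' : p ≠ ⊤) :
    eLpNorm (moll φ u) p volume ≤ eLpNorm u p volume := by
  have : moll φ u = fun x => ∫ t, u (x - t) ∂bumpMeasure φ :=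
    funext (moll_eq_integral_bumpMeasure φ u)
  rw [this]
  refine eLpNorm_integral_le hp hp' (K := fun x t => u (x - t))
    (hu.comp_measurable (measurable_fst.sub measurable_snd)) (Eventually.of_forall fun t => ?_)
  exact (eLpNorm_comp_sub_right u hu.aestronglyMeasurable t).le

theorem integrable_normed_smul_comp_sub (φ : ContDiffBump (0 : Eucl N)) {u : Eucl N → E}
    (hu : LocallyIntegrable u volume) (x : Eucl N) :
    Integrable (fun t => φ.normed volume t • u (x - t)) volume :=
  (φ.hasCompactSupport_normed.convolutionExists_left (ContinuousLinearMap.lsmul ℝ ℝ)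
    φ.continuous_normed hu) x

end Mollifier

variable {N : ℕ}

theorem fderiv_moll_apply (φ : ContDiffBump (0 : Eucl N)) {u : Eucl N → ℂ}
    (hu : LocallyIntegrable u volume) (x e : Eucl N) :
    fderiv ℝ (moll φ u) x e = ∫ t, (fderiv ℝ (φ.normed volume) (x - t) e) • u t := by
  have h := (φ.hasCompactSupport_normed (μ := volume)).hasFDerivAt_convolution_left
    (ContinuousLinearMap.lsmul ℝ ℝ) φ.contDiff_normed hu x
  have hex := ((φ.hasCompactSupport_normed (μ := volume)).fderiv (𝕜 := ℝ)).convolutionExists_left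
    ((ContinuousLinearMap.lsmul ℝ ℝ : ℝ →L[ℝ] ℂ →L[ℝ] ℂ).precompL (Eucl N))
    (φ.contDiff_normed.continuous_fderiv one_ne_zero) hu x
  have h1 : fderiv ℝ (moll φ u) x e = ∫ t, (fderiv ℝ (φ.normed volume) t e) • u (x - t) := by
    rw [moll, h.fderiv, convolution_def, ContinuousLinearMap.integral_apply hex]
    rfl
  rw [h1, ← integral_sub_left_eq_self _ volume x]
  simp only [sub_sub_cancel]

theorem moll_coord (φ : ContDiffBump (0 : Eucl N)) {g : Eucl N → EuclideanSpace ℂ (Fin N)}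
    (hg : LocallyIntegrable g volume) (x : Eucl N) (i : Fin N) :
    (moll φ g x) i = ∫ t, φ.normed volume (x - t) • (g t) i := by
  have h := ((EuclideanSpace.proj i : EuclideanSpace ℂ (Fin N) →L[ℂ] ℂ).restrictScalars
    ℝ).integral_comp_comm (integrable_normed_smul_comp_sub φ hg x)
  rw [moll_apply]
  refine h.symm.trans ?_
  rw [← integral_sub_left_eq_self _ volume x]
  refine integral_congr_ae (Eventually.of_forall fun t => ?_)
  simp

/-- The weak gradient identity is tested with `s ↦ φ(x - s)`; the sign from the reflection cancels
the sign from integration by parts. -/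
theorem fderiv_moll_single (φ : ContDiffBump (0 : Eucl N)) {u : Eucl N → ℂ}
    {g : Eucl N → EuclideanSpace ℂ (Fin N)} (hu : LocallyIntegrable u volume)
    (hg : LocallyIntegrable g volume) (h : IsWeakGradient u g) (x : Eucl N) (i : Fin N) :
    fderiv ℝ (moll φ u) x (EuclideanSpace.single i 1) = (moll φ g x) i := by
  rw [fderiv_moll_apply φ hu, moll_coord φ hg]
  have hd : ∀ t, fderiv ℝ (fun s => φ.normed volume (x - s)) t
      = -fderiv ℝ (φ.normed volume) (x - t) := fun t => by
    have h1 : HasFDerivAt (fun s : Eucl N => x - s) (-ContinuousLinearMap.id ℝ (Eucl N)) t := by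
      simpa using (hasFDerivAt_id (𝕜 := ℝ) t).const_sub x
    have h2 := (φ.contDiff_normed (μ := volume) (n := 1)).differentiable one_ne_zero (x - t)
    refine (h2.hasFDerivAt.comp t h1).fderiv.trans ?_
    ext; simp
  have h' := h (fun s => φ.normed volume (x - s))
    ((φ.contDiff_normed (n := ⊤)).comp (contDiff_const.sub contDiff_id))
    (φ.hasCompactSupport_normed.comp_homeomorph (Homeomorph.subLeft x)) i
  simp only [hd, neg_apply, neg_smul, integral_neg, neg_inj] at h'
  exact h'

/-- Cauchy–Schwarz on coordinates: the operator norm used by the calculus library is dominated by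
the Euclidean norm that enters `gradNorm`, with no dimensional constant. -/
theorem norm_le_of_apply_single {L : Eucl N →L[ℝ] ℂ} {v : EuclideanSpace ℂ (Fin N)}
    (h : ∀ i, L (EuclideanSpace.single i 1) = v i) : ‖L‖ ≤ ‖v‖ := by
  refine L.opNorm_le_bound (norm_nonneg _) fun e => ?_
  have he : e = ∑ i, e i • EuclideanSpace.single i (1 : ℝ) := by
    ext j; simp [Finset.sum_apply, Pi.single_apply]
  have h1 : L e = ∑ i, e i • v i := by
    conv_lhs => rw [he, map_sum]
    simp [h]
  calc ‖L e‖ ≤ ∑ i, ‖v i‖ * ‖e i‖ := by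
        rw [h1]
        refine (norm_sum_le _ _).trans (Finset.sum_le_sum fun i _ => ?_)
        rw [norm_smul, mul_comm]
    _ ≤ √(∑ i, ‖v i‖ ^ 2) * √(∑ i, ‖e i‖ ^ 2) := Real.sum_mul_le_sqrt_mul_sqrt _ _ _
    _ = ‖v‖ * ‖e‖ := by rw [EuclideanSpace.norm_eq, EuclideanSpace.norm_eq]

theorem norm_fderiv_moll_le (φ : ContDiffBump (0 : Eucl N)) {u : Eucl N → ℂ}
    {g : Eucl N → EuclideanSpace ℂ (Fin N)} (hu : LocallyIntegrable u volume)
    (hg : LocallyIntegrable g volume) (h : IsWeakGradient u g) (x : Eucl N) :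
    ‖fderiv ℝ (moll φ u) x‖ ≤ ‖moll φ g x‖ :=
  norm_le_of_apply_single fun i => fderiv_moll_single φ hu hg h x i

theorem contDiff_moll (φ : ContDiffBump (0 : Eucl N)) {u : Eucl N → ℂ}
    (hu : LocallyIntegrable u volume) : ContDiff ℝ 1 (moll φ u) :=
  φ.hasCompactSupport_normed.contDiff_convolution_left (n := 1) (ContinuousLinearMap.lsmul ℝ ℝ)
    φ.contDiff_normed hu

theorem eLpNorm_fderiv_moll_le (φ : ContDiffBump (0 : Eucl N)) {u : Eucl N → ℂ}
    {g : Eucl N → EuclideanSpace ℂ (Fin N)} (hu : LocallyIntegrable u volume)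
    (hgm : StronglyMeasurable g) (hg : LocallyIntegrable g volume) (h : IsWeakGradient u g) :
    eLpNorm (fderiv ℝ (moll φ u)) 2 volume ≤ eLpNorm g 2 volume :=
  (eLpNorm_mono (norm_fderiv_moll_le φ hu hg h)).trans
    (eLpNorm_moll_le φ hgm (by norm_num) (by norm_num))

/-- A sequence of bump functions concentrating at the origin. -/
noncomputable def bumpSeq (N n : ℕ) : ContDiffBump (0 : Eucl N) :=
  ⟨(1 / (n + 1) : ℝ) / 2, 1 / (n + 1), by positivity, half_lt_self (by positivity)⟩

theorem tendsto_rOut_bumpSeq : Tendsto (fun n => (bumpSeq N n).rOut) atTop (𝓝 0) :=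
  tendsto_one_div_add_atTop_nhds_zero_nat

theorem ae_tendsto_moll {E : Type*} [NormedAddCommGroup E] [NormedSpace ℝ E] [CompleteSpace E]
    {u : Eucl N → E} (hu : LocallyIntegrable u volume) :
    ∀ᵐ x, Tendsto (fun n => moll (bumpSeq N n) u x) atTop (𝓝 (u x)) := by
  refine ContDiffBump.ae_convolution_tendsto_right_of_locallyIntegrable (K := 2)
    tendsto_rOut_bumpSeq (Eventually.of_forall fun n => ?_) hu
  simp only [bumpSeq]
  linarith

/-- The increment is the average over `t ∈ (0, 1]` of the derivative at `x - t y` in direction `y`;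
Minkowski's inequality and translation invariance conclude. -/
theorem eLpNorm_sub_translate_le_fderiv {v : Eucl N → ℂ} (hv : ContDiff ℝ 1 v) (y : Eucl N) :
    eLpNorm (fun x => v x - v (x - y)) 2 volume
      ≤ ENNReal.ofReal ‖y‖ * eLpNorm (fderiv ℝ v) 2 volume := by
  have hc : Continuous fun z : Eucl N × ℝ => fderiv ℝ v (z.1 - z.2 • y) y :=
    ((hv.continuous_fderiv one_ne_zero).comp (by fun_prop)).clm_apply continuous_const
  have : IsProbabilityMeasure (volume.restrict (Ioc (0 : ℝ) 1)) := ⟨by simp⟩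
  have key : (fun x => v x - v (x - y))
      = fun x => ∫ t, fderiv ℝ v (x - t • y) y ∂(volume.restrict (Ioc (0 : ℝ) 1)) := by
    funext x
    have hd : ∀ t ∈ uIcc (0 : ℝ) 1, HasDerivAt (fun t : ℝ => -v (x - t • y))
        (fderiv ℝ v (x - t • y) y) t := fun t _ => by
      have h1 : HasDerivAt (fun t : ℝ => x - t • y) (-y) t := by
        simpa using ((hasDerivAt_id t).smul_const y).const_sub x
      have h2 := (hv.differentiable one_ne_zero (x - t • y)).hasFDerivAt
      have h3 := (h2.comp_hasDerivAt t h1).neg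
      rw [map_neg, neg_neg] at h3
      exact h3
    have hi := intervalIntegral.integral_eq_sub_of_hasDerivAt hd
      ((hc.comp (by fun_prop : Continuous fun t : ℝ => (x, t))).intervalIntegrable 0 1)
    rw [← intervalIntegral.integral_of_le zero_le_one, hi]
    simp; ring
  rw [key]
  refine eLpNorm_integral_le (by norm_num) (by norm_num)
    (K := fun x t => fderiv ℝ v (x - t • y) y) hc.stronglyMeasurable
    (Eventually.of_forall fun t => ?_)
  refine (eLpNorm_le_mul_eLpNorm_of_ae_le_mul (g := fun x => fderiv ℝ v (x - t • y)) (c := ‖y‖)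
    (Eventually.of_forall fun x => ?_) 2).trans ?_
  · rw [mul_comm]; exact ContinuousLinearMap.le_opNorm _ _
  · rw [eLpNorm_comp_sub_right _ (hv.continuous_fderiv one_ne_zero).aestronglyMeasurable]

/-- Fatou's lemma, used to carry uniform bounds from mollifications to their almost everywhere
limit. -/
theorem eLpNorm_le_of_ae_tendsto {X E : Type*} [MeasurableSpace X] [NormedAddCommGroup E]
    {μ : Measure X} {p : ℝ≥0∞} {f : ℕ → X → E} {f₀ : X → E} {M : ℝ≥0∞}
    (hf : ∀ n, AEStronglyMeasurable (f n) μ) (hM : ∀ n, eLpNorm (f n) p μ ≤ M)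
    (h : ∀ᵐ x ∂μ, Tendsto (fun n => f n x) atTop (𝓝 (f₀ x))) : eLpNorm f₀ p μ ≤ M := by
  refine (Lp.eLpNorm_lim_le_liminf_eLpNorm hf _ h).trans ?_
  exact (liminf_le_liminf (Eventually.of_forall hM)).trans (liminf_const M).le

theorem eLpNorm_sub_translate_le {u : Eucl N → ℂ} {g : Eucl N → EuclideanSpace ℂ (Fin N)}
    (hu : LocallyIntegrable u volume) (hgm : StronglyMeasurable g)
    (hg : LocallyIntegrable g volume) (h : IsWeakGradient u g) (y : Eucl N) :
    eLpNorm (fun x => u x - u (x - y)) 2 volume ≤ ENNReal.ofReal ‖y‖ * eLpNorm g 2 volume := by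
  refine eLpNorm_le_of_ae_tendsto
    (f := fun n x => moll (bumpSeq N n) u x - moll (bumpSeq N n) u (x - y))
    (fun n => ?_) (fun n => ?_) ?_
  · have := (contDiff_moll (bumpSeq N n) hu).continuous
    exact (by fun_prop : Continuous _).aestronglyMeasurable
  · refine (eLpNorm_sub_translate_le_fderiv (contDiff_moll (bumpSeq N n) hu) y).trans ?_
    gcongr
    exact eLpNorm_fderiv_moll_le _ hu hgm hg h
  · have h1 := ae_tendsto_moll hu
    have h2 := (measurePreserving_sub_right volume y).quasiMeasurePreserving.ae h1
    filter_upwards [h1, h2] with x hx hx' using hx.sub hx'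

/-- The error is the average of `u - u(· - t)` over `‖t‖ ≤ rOut`. This rate, uniform over bounded
sets of `H¹`, drives both the nonvanishing argument and local compactness. -/
theorem eLpNorm_sub_moll_le (φ : ContDiffBump (0 : Eucl N)) {u : Eucl N → ℂ}
    {g : Eucl N → EuclideanSpace ℂ (Fin N)} (hum : StronglyMeasurable u)
    (hu : LocallyIntegrable u volume) (hgm : StronglyMeasurable g)
    (hg : LocallyIntegrable g volume) (h : IsWeakGradient u g) :
    eLpNorm (fun x => u x - moll φ u x) 2 volume
      ≤ ENNReal.ofReal φ.rOut * eLpNorm g 2 volume := by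
  have key : (fun x => u x - moll φ u x)
      = fun x => ∫ t, (u x - u (x - t)) ∂bumpMeasure φ := by
    funext x
    have hi : Integrable (fun t => u (x - t)) (bumpMeasure φ) := by
      rw [bumpMeasure, integrable_withDensity_iff_integrable_smul' (measurable_ofReal_normed φ)
        (Eventually.of_forall fun _ => ENNReal.ofReal_lt_top)]
      simp only [ENNReal.toReal_ofReal (φ.nonneg_normed _)]
      exact integrable_normed_smul_comp_sub φ hu x
    rw [integral_sub (integrable_const _) hi, moll_eq_integral_bumpMeasure]
    simp
  rw [key]
  refine eLpNorm_integral_le (by norm_num) (by norm_num) (K := fun x t => u x - u (x - t))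
    ((hum.comp_measurable measurable_fst).sub
      (hum.comp_measurable (measurable_fst.sub measurable_snd))) ?_
  filter_upwards [ae_bumpMeasure_norm_le φ] with t ht
  exact (eLpNorm_sub_translate_le hu hgm hg h t).trans (by gcongr)

/-! ### The Sobolev inequality on the whole space. -/

/-- A fixed smooth function equal to `1` on the unit ball and supported in the ball of radius `2`. -/
noncomputable def stdBump (N : ℕ) : ContDiffBump (0 : Eucl N) := ⟨1, 2, one_pos, one_lt_two⟩

/-- Smooth cutoff functions exhausting the space. -/
noncomputable def cutoff (N n : ℕ) (x : Eucl N) : ℝ := stdBump N ((1 / (n + 1) : ℝ) • x)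

theorem contDiff_cutoff (n : ℕ) : ContDiff ℝ 1 (cutoff N n) :=
  (stdBump N).contDiff.comp (contDiff_const_smul _)

theorem hasCompactSupport_cutoff (n : ℕ) : HasCompactSupport (cutoff N n) :=
  (stdBump N).hasCompactSupport.comp_homeomorph
    (Homeomorph.smulOfNeZero (1 / (n + 1) : ℝ) (by positivity))

theorem norm_cutoff_le (n : ℕ) (x : Eucl N) : ‖cutoff N n x‖ ≤ 1 := by
  rw [cutoff, Real.norm_of_nonneg (stdBump N).nonneg]
  exact (stdBump N).le_one

theorem exists_norm_fderiv_cutoff_le (N : ℕ) :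
    ∃ C : ℝ, 0 ≤ C ∧ ∀ n (x : Eucl N), ‖fderiv ℝ (cutoff N n) x‖ ≤ C * (1 / (n + 1)) := by
  have hs := (stdBump N).contDiff (n := 1)
  obtain ⟨C, hC⟩ := ((stdBump N).hasCompactSupport.fderiv (𝕜 := ℝ)).exists_bound_of_continuous
    (hs.continuous_fderiv one_ne_zero)
  refine ⟨C, (norm_nonneg _).trans (hC 0), fun n x => ?_⟩
  have h1 : HasFDerivAt (fun x : Eucl N => (1 / (n + 1) : ℝ) • x)
      ((1 / (n + 1) : ℝ) • ContinuousLinearMap.id ℝ (Eucl N)) x :=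
    ((1 / (n + 1) : ℝ) • ContinuousLinearMap.id ℝ (Eucl N)).hasFDerivAt
  have h2 : fderiv ℝ (cutoff N n) x
      = (1 / (n + 1) : ℝ) • fderiv ℝ (stdBump N) ((1 / (n + 1) : ℝ) • x) := by
    refine ((hs.differentiable one_ne_zero _).hasFDerivAt.comp x h1).fderiv.trans ?_
    ext; simp
  rw [h2, norm_smul, Real.norm_of_nonneg (by positivity), mul_comm]
  gcongr
  exact hC _

theorem tendsto_cutoff (x : Eucl N) : Tendsto (fun n => cutoff N n x) atTop (𝓝 1) := by
  refine tendsto_const_nhds.congr' ?_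
  obtain ⟨m, hm⟩ := exists_nat_gt ‖x‖
  filter_upwards [eventually_ge_atTop m] with n hn
  refine ((stdBump N).one_of_mem_closedBall ?_).symm
  rw [mem_closedBall_zero_iff, norm_smul, Real.norm_of_nonneg (by positivity)]
  have : (m : ℝ) ≤ n := by exact_mod_cast hn
  change 1 / ((n : ℝ) + 1) * ‖x‖ ≤ 1
  rw [one_div_mul_eq_div, div_le_one (by positivity)]
  linarith

theorem critExp_gt_two (hN : 3 ≤ N) : 2 < critExp N := by
  have : (3 : ℝ) ≤ N := by exact_mod_cast hN
  rw [critExp, lt_div_iff₀ (by linarith)]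
  linarith

theorem sobolev_of_hasCompactSupport (hN : 3 ≤ N) : ∃ κ : NNReal, ∀ v : Eucl N → ℂ,
    ContDiff ℝ 1 v → HasCompactSupport v → eLpNorm v (ENNReal.ofReal (critExp N)) volume
      ≤ κ * eLpNorm (fderiv ℝ v) 2 volume := by
  refine ⟨eLpNormLESNormFDerivOfEqInnerConst (volume : Measure (Eucl N)) 2, fun v hv hc => ?_⟩
  have h3 : (3 : ℝ) ≤ N := by exact_mod_cast hN
  have h := eLpNorm_le_eLpNorm_fderiv_of_eq_inner (volume : Measure (Eucl N)) hv hc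
    (p := 2) (p' := (critExp N).toNNReal) (by norm_num) (by simp; omega) (by
      have h2 : (N : ℝ) - 2 ≠ 0 := by linarith
      have h4 : (N : ℝ) ≠ 0 := by linarith
      rw [Real.coe_toNNReal _ (by linarith [critExp_gt_two hN]), finrank_euclideanSpace_fin, critExp]
      push_cast
      field_simp)
  exact_mod_cast h

theorem eLpNorm_fderiv_cutoff_smul_le {v : Eucl N → ℂ} (hv : ContDiff ℝ 1 v) {C : ℝ} (hC0 : 0 ≤ C)
    {n : ℕ} (hC : ∀ x : Eucl N, ‖fderiv ℝ (cutoff N n) x‖ ≤ C) :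
    eLpNorm (fderiv ℝ fun x => cutoff N n x • v x) 2 volume
      ≤ eLpNorm (fderiv ℝ v) 2 volume + ENNReal.ofReal C * eLpNorm v 2 volume := by
  have hle : ∀ x, ‖fderiv ℝ (fun x => cutoff N n x • v x) x‖
      ≤ ‖fderiv ℝ v x‖ + C * ‖v x‖ := fun x => by
    rw [fderiv_fun_smul ((contDiff_cutoff n).differentiable one_ne_zero x)
      (hv.differentiable one_ne_zero x)]
    refine (norm_add_le _ _).trans (add_le_add ?_ ?_)
    · rw [norm_smul]
      exact mul_le_of_le_one_left (norm_nonneg _) (norm_cutoff_le n x)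
    · rw [ContinuousLinearMap.norm_smulRight_apply]
      gcongr
      exact hC x
  refine (eLpNorm_mono_real hle).trans ?_
  have hvc := hv.continuous
  refine (eLpNorm_add_le (hv.continuous_fderiv one_ne_zero).norm.aestronglyMeasurable
    (by exact (by fun_prop : Continuous fun x => C * ‖v x‖).aestronglyMeasurable)
    (by norm_num)).trans ?_
  rw [eLpNorm_norm]
  gcongr
  exact eLpNorm_le_mul_eLpNorm_of_ae_le_mul (Eventually.of_forall fun x => by
    rw [norm_mul, norm_norm, Real.norm_of_nonneg hC0]) 2

/-- Compact support is removed by cutoffs: their derivatives are `O(1/(n+1))`, so the product rule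
costs a multiple of `‖v‖₂/(n+1)`, which disappears in the limit because `v ∈ L²`. -/
theorem sobolev_of_contDiff {κ : NNReal} (hκ : ∀ v : Eucl N → ℂ,
      ContDiff ℝ 1 v → HasCompactSupport v → eLpNorm v (ENNReal.ofReal (critExp N)) volume
      ≤ κ * eLpNorm (fderiv ℝ v) 2 volume) {v : Eucl N → ℂ} (hv : ContDiff ℝ 1 v)
    (h2 : eLpNorm v 2 volume ≠ ⊤) : eLpNorm v (ENNReal.ofReal (critExp N)) volume
      ≤ κ * eLpNorm (fderiv ℝ v) 2 volume := by
  obtain ⟨C, hC0, hC⟩ := exists_norm_fderiv_cutoff_le N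
  have hcd : ∀ n, ContDiff ℝ 1 (fun x => cutoff N n x • v x) := fun n =>
    (contDiff_cutoff n).smul hv
  have hbd : ∀ n : ℕ, eLpNorm (fun x => cutoff N n x • v x) (ENNReal.ofReal (critExp N)) volume
      ≤ κ * (eLpNorm (fderiv ℝ v) 2 volume
        + ENNReal.ofReal (C * (1 / (n + 1))) * eLpNorm v 2 volume) := fun n => by
    refine (hκ _ (hcd n) ((hasCompactSupport_cutoff n).smul_right)).trans ?_
    gcongr
    exact eLpNorm_fderiv_cutoff_smul_le hv (by positivity) (hC n)
  refine (Lp.eLpNorm_lim_le_liminf_eLpNorm (fun n => (hcd n).continuous.aestronglyMeasurable) v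
    (Eventually.of_forall fun x => ?_)).trans ?_
  · simpa using (tendsto_cutoff x).smul_const (v x)
  · refine (liminf_le_liminf (Eventually.of_forall hbd)).trans (Tendsto.liminf_eq ?_).le
    refine ENNReal.Tendsto.const_mul ?_ (Or.inr ENNReal.coe_ne_top)
    have h0 : Tendsto (fun n : ℕ => ENNReal.ofReal (C * (1 / (n + 1)))) atTop (𝓝 0) := by
      have := (tendsto_one_div_add_atTop_nhds_zero_nat (𝕜 := ℝ)).const_mul C
      rw [mul_zero] at this
      simpa only [ENNReal.ofReal_zero] using ENNReal.tendsto_ofReal this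
    have h3 := (ENNReal.Tendsto.mul_const h0 (Or.inr h2)).const_add (eLpNorm (fderiv ℝ v) 2 volume)
    rwa [zero_mul, add_zero] at h3

/-- The Sobolev inequality on `H¹`, with a non-optimal constant. -/
theorem sobolev_of_isWeakGradient (hN : 3 ≤ N) : ∃ κ : NNReal, ∀ (u : Eucl N → ℂ)
    (g : Eucl N → EuclideanSpace ℂ (Fin N)), StronglyMeasurable u → MemLp u 2 volume →
    StronglyMeasurable g → MemLp g 2 volume → IsWeakGradient u g →
    eLpNorm u (ENNReal.ofReal (critExp N)) volume ≤ κ * eLpNorm g 2 volume := by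
  obtain ⟨κ, hκ⟩ := sobolev_of_hasCompactSupport hN
  refine ⟨κ, fun u g hum hu hgm hg h => ?_⟩
  have hul := hu.locallyIntegrable (by norm_num)
  have hgl := hg.locallyIntegrable (by norm_num)
  refine eLpNorm_le_of_ae_tendsto (f := fun n => moll (bumpSeq N n) u)
    (fun n => (contDiff_moll (bumpSeq N n) hul).continuous.aestronglyMeasurable) (fun n => ?_)
    (ae_tendsto_moll hul)
  refine (sobolev_of_contDiff hκ (contDiff_moll _ hul) ?_).trans ?_
  · exact ((eLpNorm_moll_le _ hum (by norm_num) (by norm_num)).trans_lt hu.2).ne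
  · gcongr
    exact eLpNorm_fderiv_moll_le _ hul hgm hgl h

/-! ### Interpolation and the Lebesgue norms on H¹. -/

/-- Interpolation between `L²` and `L^r`. -/
theorem lintegral_rpow_interpolation {X : Type*} [MeasurableSpace X] {μ : Measure X}
    {f : X → ℝ≥0∞} (hf : AEMeasurable f μ) {q r : ℝ} (hq : 2 < q) (hr : q < r) :
    ∫⁻ x, f x ^ q ∂μ ≤ (∫⁻ x, f x ^ (2 : ℝ) ∂μ) ^ ((r - q) / (r - 2))
      * (∫⁻ x, f x ^ r ∂μ) ^ ((q - 2) / (r - 2)) := by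
  have h0 : 0 < r - 2 := by linarith
  -- Hölder's inequality for the splitting `q = 2 (r-q)/(r-2) + r (q-2)/(r-2)`, whose two weights
  -- add up to one.
  refine le_trans (le_of_eq ?_) (ENNReal.lintegral_mul_norm_pow_le (hf.pow_const 2)
    (hf.pow_const r) (p := (r - q) / (r - 2)) (q := (q - 2) / (r - 2))
    (div_nonneg (by linarith) h0.le) (div_nonneg (by linarith) h0.le) (by field_simp; ring))
  refine lintegral_congr fun x => ?_
  rw [← ENNReal.rpow_mul, ← ENNReal.rpow_mul, ← ENNReal.rpow_add_of_nonneg]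
  · congr 1; field_simp; ring
  · exact mul_nonneg (by norm_num) (div_nonneg (by linarith) h0.le)
  · exact mul_nonneg (by linarith) (div_nonneg (by linarith) h0.le)

theorem fn_add (u v : H1 N) : fn (u + v) = fn u + fn v := rfl
theorem fn_sub (u v : H1 N) : fn (u - v) = fn u - fn v := rfl
theorem fn_smul (z : ℂ) (u : H1 N) : fn (z • u) = z • fn u := rfl
theorem grad_smul (z : ℂ) (u : H1 N) : grad (z • u) = z • grad u := rfl

theorem gradNorm_nonneg (u : H1 N) : 0 ≤ gradNorm u := norm_nonneg _

theorem normLp_nonneg (p : ℝ) (u : H1 N) : 0 ≤ normLp p u := lpNorm_nonneg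

theorem gradNorm_smul (z : ℂ) (u : H1 N) : gradNorm (z • u) = ‖z‖ * gradNorm u := by
  rw [gradNorm, grad_smul, norm_smul, gradNorm]

theorem normLp_smul (p : ℝ) (z : ℂ) (u : H1 N) : normLp p (z • u) = ‖z‖ * normLp p u := by
  rw [normLp, fn_smul, lpNorm, if_pos (Lp.aestronglyMeasurable _),
    eLpNorm_congr_ae (Lp.coeFn_smul z (fn u)), eLpNorm_const_smul, ENNReal.toReal_mul, normLp,
    lpNorm, if_pos (Lp.aestronglyMeasurable _)]
  simp

theorem normLp_eq_toReal (p : ℝ) (u : H1 N) :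
    normLp p u = (eLpNorm (fn u) (ENNReal.ofReal p) volume).toReal := by
  rw [normLp, lpNorm, if_pos (Lp.aestronglyMeasurable _)]

theorem normLp_two (u : H1 N) : normLp 2 u = ‖fn u‖ := by
  rw [normLp_eq_toReal, Lp.norm_def]
  norm_num

theorem norm_sq_eq (u : H1 N) : ‖u‖ ^ 2 = normLp 2 u ^ 2 + gradNorm u ^ 2 := by
  rw [normLp_two]
  exact WithLp.prod_norm_sq_eq_of_L2 (u : WithLp 2 (L2 N × L2Vec N))

theorem gradNorm_shift (y : Eucl N) (u : H1 N) : gradNorm (shift y u) = gradNorm u :=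
  Lp.norm_compMeasurePreserving _ _

theorem fn_shift_ae (y : Eucl N) (u : H1 N) :
    fn (shift y u) =ᵐ[volume] fun x => fn u (x - y) :=
  Lp.coeFn_compMeasurePreserving _ _

theorem normLp_shift (p : ℝ) (y : Eucl N) (u : H1 N) : normLp p (shift y u) = normLp p u := by
  rw [normLp_eq_toReal, normLp_eq_toReal, eLpNorm_congr_ae (fn_shift_ae y u),
    eLpNorm_comp_sub_right _ (Lp.aestronglyMeasurable _)]

theorem energy_shift (q μ : ℝ) (y : Eucl N) (u : H1 N) :
    energy q μ (shift y u) = energy q μ u := by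
  rw [energy, energy, gradNorm_shift, normLp_shift, normLp_shift]

/-- Integrability is recorded next to the estimate, since `normLp` is a `toReal` and is zero when
the norm is infinite. -/
theorem exists_normLp_critExp_le (hN : 3 ≤ N) : ∃ κ : ℝ, 0 < κ ∧ ∀ u : H1 N,
    MemLp (fn u) (ENNReal.ofReal (critExp N)) volume ∧
      normLp (critExp N) u ≤ κ * gradNorm u := by
  obtain ⟨κ, hκ⟩ := sobolev_of_isWeakGradient hN
  -- Adding one makes the constant strictly positive.
  refine ⟨κ + 1, by positivity, fun u => ?_⟩
  have h := hκ (fn u) (grad u) (Lp.stronglyMeasurable _) (Lp.memLp _) (Lp.stronglyMeasurable _)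
    (Lp.memLp _) u.2
  have hfin : (κ : ℝ≥0∞) * eLpNorm (grad u) 2 volume ≠ ⊤ :=
    ENNReal.mul_ne_top ENNReal.coe_ne_top (Lp.memLp _).2.ne
  refine ⟨⟨Lp.aestronglyMeasurable _, h.trans_lt hfin.lt_top⟩, ?_⟩
  have h1 := ENNReal.toReal_mono hfin h
  rw [ENNReal.toReal_mul, ← normLp_eq_toReal, ENNReal.coe_toReal, ← Lp.norm_def] at h1
  refine h1.trans ?_
  rw [gradNorm]
  gcongr
  simp

theorem memLp_critExp (hN : 3 ≤ N) (u : H1 N) :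
    MemLp (fn u) (ENNReal.ofReal (critExp N)) volume := by
  obtain ⟨κ, -, h⟩ := exists_normLp_critExp_le hN
  exact (h u).1

theorem memLp_of_critExp {X E : Type*} [MeasurableSpace X] [NormedAddCommGroup E] {μ : Measure X}
    {f : X → E} {q r : ℝ} (hq : 2 < q) (hr : q < r) (h2 : MemLp f 2 μ)
    (hf : MemLp f (ENNReal.ofReal r) μ) : MemLp f (ENNReal.ofReal q) μ := by
  have h0 : 0 < r - 2 := by linarith
  refine ⟨h2.1, ?_⟩
  have hq0 : ENNReal.ofReal q ≠ 0 := by simp; linarith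
  have hr0 : ENNReal.ofReal r ≠ 0 := by simp; linarith
  rw [eLpNorm_lt_top_iff_lintegral_rpow_enorm_lt_top hq0 ENNReal.ofReal_ne_top,
    ENNReal.toReal_ofReal (by linarith)]
  refine (lintegral_rpow_interpolation h2.1.enorm hq hr).trans_lt ?_
  have h3 := lintegral_rpow_enorm_lt_top_of_eLpNorm_lt_top (by norm_num) (by norm_num) h2.2
  have h4 := lintegral_rpow_enorm_lt_top_of_eLpNorm_lt_top hr0 ENNReal.ofReal_ne_top hf.2
  rw [ENNReal.toReal_ofReal (by linarith)] at h4
  rw [ENNReal.toReal_ofNat] at h3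
  exact ENNReal.mul_lt_top
    (ENNReal.rpow_lt_top_of_nonneg (div_nonneg (by linarith) h0.le) h3.ne)
    (ENNReal.rpow_lt_top_of_nonneg (div_nonneg (by linarith) h0.le) h4.ne)

theorem lt_critExp (hN : 3 ≤ N) {q : ℝ} (hq' : q < 2 + 4 / N) : q < critExp N := by
  have h3 : (3 : ℝ) ≤ N := by exact_mod_cast hN
  refine hq'.trans_le ?_
  have h : critExp N - (2 + 4 / N) = 8 / (N * (N - 2)) := by
    have h2 : (N : ℝ) - 2 ≠ 0 := by linarith
    have h4 : (N : ℝ) ≠ 0 := by linarith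
    rw [critExp]
    field_simp
    ring
  have : 0 ≤ 8 / ((N : ℝ) * (N - 2)) := div_nonneg (by norm_num) (by nlinarith)
  linarith

theorem memLp_subcritical (hN : 3 ≤ N) {q : ℝ} (hq : 2 < q) (hq' : q < 2 + 4 / N) (u : H1 N) :
    MemLp (fn u) (ENNReal.ofReal q) volume :=
  memLp_of_critExp hq (lt_critExp hN hq') (Lp.memLp _) (memLp_critExp hN u)

theorem toReal_eLpNorm_rpow {X E : Type*} [MeasurableSpace X] [NormedAddCommGroup E]
    {μ : Measure X} {f : X → E} {p : ℝ} (hp : 0 < p) :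
    (eLpNorm f (ENNReal.ofReal p) μ).toReal ^ p = (∫⁻ x, ‖f x‖ₑ ^ p ∂μ).toReal := by
  rw [eLpNorm_eq_lintegral_rpow_enorm_toReal (by simpa using hp) ENNReal.ofReal_ne_top,
    ENNReal.toReal_ofReal hp.le, ENNReal.toReal_rpow, ← ENNReal.rpow_mul,
    one_div_mul_cancel hp.ne', ENNReal.rpow_one]

theorem normLp_rpow {p : ℝ} (hp : 0 < p) (u : H1 N) :
    normLp p u ^ p = (∫⁻ x, ‖fn u x‖ₑ ^ p).toReal := by
  rw [normLp_eq_toReal, toReal_eLpNorm_rpow hp]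

theorem toReal_interpolation {X E : Type*} [MeasurableSpace X] [NormedAddCommGroup E]
    {μ : Measure X} {f : X → E} {q r : ℝ} (hq : 2 < q) (hr : q < r) (h2 : MemLp f 2 μ)
    (hf : MemLp f (ENNReal.ofReal r) μ) :
    (eLpNorm f (ENNReal.ofReal q) μ).toReal ^ q
      ≤ ((eLpNorm f 2 μ).toReal ^ 2) ^ ((r - q) / (r - 2))
        * ((eLpNorm f (ENNReal.ofReal r) μ).toReal ^ r) ^ ((q - 2) / (r - 2)) := by
  have h0 : 0 < r - 2 := by linarith
  have hr0 : ENNReal.ofReal r ≠ 0 := by simp; linarith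
  have h3 := lintegral_rpow_enorm_lt_top_of_eLpNorm_lt_top (by norm_num) (by norm_num) h2.2
  have h4 := lintegral_rpow_enorm_lt_top_of_eLpNorm_lt_top hr0 ENNReal.ofReal_ne_top hf.2
  rw [ENNReal.toReal_ofReal (by linarith)] at h4
  rw [ENNReal.toReal_ofNat] at h3
  have h5 : (eLpNorm f 2 μ).toReal ^ 2 = (∫⁻ x, ‖f x‖ₑ ^ (2 : ℝ) ∂μ).toReal := by
    rw [← toReal_eLpNorm_rpow (by norm_num)]; norm_num
  rw [toReal_eLpNorm_rpow (by linarith), toReal_eLpNorm_rpow (by linarith), h5,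
    ENNReal.toReal_rpow, ENNReal.toReal_rpow, ← ENNReal.toReal_mul]
  refine ENNReal.toReal_mono ?_ (lintegral_rpow_interpolation h2.1.enorm hq hr)
  exact (ENNReal.mul_lt_top
    (ENNReal.rpow_lt_top_of_nonneg (div_nonneg (by linarith) h0.le) h3.ne)
    (ENNReal.rpow_lt_top_of_nonneg (div_nonneg (by linarith) h0.le) h4.ne)).ne

/-- The element of `H¹` given by a square integrable function and its weak gradient. -/
noncomputable def ofMemLp (u : Eucl N → ℂ) (g : Eucl N → EuclideanSpace ℂ (Fin N))
    (hu : MemLp u 2 volume) (hg : MemLp g 2 volume) (h : IsWeakGradient u g) : H1 N :=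
  ⟨WithLp.toLp 2 (hu.toLp, hg.toLp), h.congr hu.coeFn_toLp.symm hg.coeFn_toLp.symm⟩

theorem normLp_ofMemLp {u : Eucl N → ℂ} {g : Eucl N → EuclideanSpace ℂ (Fin N)}
    (hu : MemLp u 2 volume) (hg : MemLp g 2 volume) (h : IsWeakGradient u g) (p : ℝ) :
    normLp p (ofMemLp u g hu hg h) = (eLpNorm u (ENNReal.ofReal p) volume).toReal := by
  rw [normLp_eq_toReal]
  exact congrArg _ (eLpNorm_congr_ae hu.coeFn_toLp)

theorem gradNorm_ofMemLp {u : Eucl N → ℂ} {g : Eucl N → EuclideanSpace ℂ (Fin N)}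
    (hu : MemLp u 2 volume) (hg : MemLp g 2 volume) (h : IsWeakGradient u g) :
    gradNorm (ofMemLp u g hu hg h) = (eLpNorm g 2 volume).toReal :=
  Lp.norm_toLp g hg

/-! ### Dilated test functions, the optimal constants, and negative energy. -/

/-- The classical gradient of a real function, as a complex vector. -/
noncomputable def classicalGrad (f : Eucl N → ℝ) (x : Eucl N) : EuclideanSpace ℂ (Fin N) :=
  WithLp.toLp 2 fun i => ((fderiv ℝ f x (EuclideanSpace.single i 1) : ℝ) : ℂ)

theorem isWeakGradient_classicalGrad {f : Eucl N → ℝ} (hf : ContDiff ℝ 1 f)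
    (hc : HasCompactSupport f) : IsWeakGradient (fun x => (f x : ℂ)) (classicalGrad f) := by
  intro φ hφ hφc i
  have hφ1 : ContDiff ℝ 1 φ := hφ.of_le (by exact_mod_cast le_top)
  have hfd : ∀ {a : Eucl N → ℝ}, ContDiff ℝ 1 a →
      Continuous fun x => fderiv ℝ a x (EuclideanSpace.single i 1) := fun h =>
    (h.continuous_fderiv one_ne_zero).clm_apply continuous_const
  have h := integral_mul_fderiv_eq_neg_fderiv_mul_of_integrable (μ := volume) (f := φ) (g := f)
    (v := EuclideanSpace.single i 1)
    (((hfd hφ1).mul hf.continuous).integrable_of_hasCompactSupport (hc.mul_left))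
    ((hφ.continuous.mul (hfd hf)).integrable_of_hasCompactSupport hφc.mul_right)
    ((hφ.continuous.mul hf.continuous).integrable_of_hasCompactSupport hφc.mul_right)
    (fun x _ => hφ1.differentiable one_ne_zero x) (fun x _ => hf.differentiable one_ne_zero x)
  have e1 : ∫ x, (fderiv ℝ φ x (EuclideanSpace.single i 1)) • (f x : ℂ)
      = ((∫ x, fderiv ℝ φ x (EuclideanSpace.single i 1) * f x : ℝ) : ℂ) := by
    rw [← integral_complex_ofReal]; simp
  have e2 : ∫ x, φ x • (classicalGrad f x) i
      = ((∫ x, φ x * fderiv ℝ f x (EuclideanSpace.single i 1) : ℝ) : ℂ) := by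
    rw [← integral_complex_ofReal]; simp [classicalGrad]
  rw [e1, e2, h]
  simp

theorem continuous_classicalGrad {f : Eucl N → ℝ} (hf : ContDiff ℝ 1 f) :
    Continuous (classicalGrad f) := by
  refine (PiLp.continuous_toLp 2 _).comp (continuous_pi fun i => ?_)
  exact Complex.continuous_ofReal.comp
    ((hf.continuous_fderiv one_ne_zero).clm_apply continuous_const)

theorem hasCompactSupport_classicalGrad {f : Eucl N → ℝ} (hc : HasCompactSupport f) :
    HasCompactSupport (classicalGrad f) := by
  refine (hc.fderiv (𝕜 := ℝ)).mono' fun x hx => subset_tsupport _ fun h => hx ?_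
  ext i
  simp [classicalGrad, h]

theorem lintegral_comp_smul {s : ℝ} (hs : 0 < s) (h : Eucl N → ℝ≥0∞) :
    ∫⁻ x, h (s • x) = ENNReal.ofReal ((s ^ N)⁻¹) * ∫⁻ x, h x := by
  have he := (Homeomorph.smulOfNeZero s hs.ne' : Eucl N ≃ₜ Eucl N).measurableEmbedding.lintegral_map
    (μ := volume) h
  have hm := Measure.map_addHaar_smul (volume : Measure (Eucl N)) hs.ne'
  rw [finrank_euclideanSpace_fin, abs_of_pos (by positivity)] at hm
  rw [← smul_eq_mul, ← lintegral_smul_measure, ← hm]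
  exact he.symm

theorem toReal_eLpNorm_comp_smul_rpow {E : Type*} [NormedAddCommGroup E] {s : ℝ} (hs : 0 < s)
    (f : Eucl N → E) {p : ℝ} (hp : 0 < p) :
    (eLpNorm (fun x => f (s • x)) (ENNReal.ofReal p) volume).toReal ^ p
      = (s ^ N)⁻¹ * (eLpNorm f (ENNReal.ofReal p) volume).toReal ^ p := by
  rw [toReal_eLpNorm_rpow hp, toReal_eLpNorm_rpow hp,
    lintegral_comp_smul hs (fun x => ‖f x‖ₑ ^ p), ENNReal.toReal_mul,
    ENNReal.toReal_ofReal (by positivity)]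

theorem classicalGrad_comp_smul {f : Eucl N → ℝ} (hf : ContDiff ℝ 1 f) (s : ℝ) (x : Eucl N) :
    classicalGrad (fun x => f (s • x)) x = s • classicalGrad f (s • x) := by
  have h1 : HasFDerivAt (fun x : Eucl N => s • x) (s • ContinuousLinearMap.id ℝ (Eucl N)) x :=
    (s • ContinuousLinearMap.id ℝ (Eucl N)).hasFDerivAt
  have h2 : fderiv ℝ (fun x => f (s • x)) x = s • fderiv ℝ f (s • x) := by
    refine ((hf.differentiable one_ne_zero _).hasFDerivAt.comp x h1).fderiv.trans ?_
    ext; simp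
  ext i
  simp [classicalGrad, h2]

/-- Dilates of a fixed bump function. -/
theorem exists_dilated_family (N : ℕ) {q : ℝ} (hq : 2 < q) : ∃ J₂ Jq G : ℝ, 0 < J₂ ∧ 0 < Jq ∧
    0 ≤ G ∧ ∀ s : ℝ, 0 < s → ∃ u : H1 N, normLp 2 u ^ 2 = (s ^ N)⁻¹ * J₂ ∧
      normLp q u ^ q = (s ^ N)⁻¹ * Jq ∧ gradNorm u ^ 2 = (s ^ N)⁻¹ * (s ^ 2 * G) := by
  obtain ⟨f, hf0⟩ : ∃ f : Eucl N → ℝ, f = fun x => stdBump N x := ⟨_, rfl⟩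
  have hf : ContDiff ℝ 1 f := hf0 ▸ (stdBump N).contDiff
  have hc : HasCompactSupport f := hf0 ▸ (stdBump N).hasCompactSupport
  have hpos : ∀ p : ℝ, 0 < p →
      0 < (eLpNorm (fun x => (f x : ℂ)) (ENNReal.ofReal p) volume).toReal := fun p hp => by
    have hcont : Continuous fun x => (f x : ℂ) := Complex.continuous_ofReal.comp hf.continuous
    have hm : MemLp (fun x => (f x : ℂ)) (ENNReal.ofReal p) volume :=
      hcont.memLp_of_hasCompactSupport (hc.comp_left Complex.ofReal_zero)
    refine ENNReal.toReal_pos (fun h0 => ?_) hm.2.ne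
    rw [eLpNorm_eq_zero_iff hm.1 (by simpa using hp)] at h0
    have h1 := (Continuous.ae_eq_iff_eq volume hcont continuous_zero).1 h0
    have h2 := congrFun h1 0
    have h3 : f 0 = 1 := hf0 ▸ (stdBump N).one_of_mem_closedBall (by simp [(stdBump N).rIn_pos.le])
    simp [h3] at h2
  refine ⟨(eLpNorm (fun x => (f x : ℂ)) (ENNReal.ofReal 2) volume).toReal ^ (2 : ℝ),
    (eLpNorm (fun x => (f x : ℂ)) (ENNReal.ofReal q) volume).toReal ^ q,
    (eLpNorm (classicalGrad f) (ENNReal.ofReal 2) volume).toReal ^ (2 : ℝ),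
    Real.rpow_pos_of_pos (hpos 2 two_pos) _, Real.rpow_pos_of_pos (hpos q (by linarith)) _,
    Real.rpow_nonneg ENNReal.toReal_nonneg _, fun s hs => ?_⟩
  have hf' : ContDiff ℝ 1 (fun x => f (s • x)) := hf.comp (contDiff_const_smul _)
  have hc' : HasCompactSupport (fun x => f (s • x)) :=
    hc.comp_homeomorph (Homeomorph.smulOfNeZero s hs.ne')
  refine ⟨ofMemLp (fun x => (f (s • x) : ℂ)) (classicalGrad fun x => f (s • x))
    ((Complex.continuous_ofReal.comp hf'.continuous).memLp_of_hasCompactSupport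
      (hc'.comp_left Complex.ofReal_zero))
    ((continuous_classicalGrad hf').memLp_of_hasCompactSupport
      (hasCompactSupport_classicalGrad hc')) (isWeakGradient_classicalGrad hf' hc'), ?_, ?_, ?_⟩
  · rw [normLp_ofMemLp, ← Real.rpow_two,
      toReal_eLpNorm_comp_smul_rpow hs (fun x => (f x : ℂ)) two_pos]
  · rw [normLp_ofMemLp, toReal_eLpNorm_comp_smul_rpow hs (fun x => (f x : ℂ)) (by linarith)]
  · have h1 : (classicalGrad fun x => f (s • x)) = s • fun x => classicalGrad f (s • x) :=
      funext fun x => classicalGrad_comp_smul hf s x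
    have h2 := toReal_eLpNorm_comp_smul_rpow hs (classicalGrad f) two_pos
    rw [gradNorm_ofMemLp, h1, eLpNorm_const_smul, ENNReal.toReal_mul, mul_pow]
    norm_num at h2 ⊢
    rw [h2]
    ring

/-- A nontrivial test function: it bounds the set defining `sobolevConst` and rules out nonpositive
Gagliardo–Nirenberg constants. -/
theorem exists_normLp_pos (N : ℕ) {q : ℝ} (hq : 2 < q) :
    ∃ u : H1 N, 0 < normLp q u := by
  obtain ⟨J₂, Jq, G, -, hJ, -, h⟩ := exists_dilated_family N hq
  obtain ⟨u, -, hu, -⟩ := h 1 one_pos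
  refine ⟨u, lt_of_le_of_ne (normLp_nonneg q u) fun h0 => ?_⟩
  rw [← h0, Real.zero_rpow (by linarith)] at hu
  simp at hu
  linarith

/-- The constant from `exists_normLp_critExp_le` makes the set nonempty with a positive element, and
a test function bounds it above; otherwise the real supremum would be the default value zero. The
inequality is closed in `S`, so the supremum itself is admissible. -/
theorem sobolevConst_spec (hN : 3 ≤ N) : 0 < sobolevConst N ∧
    ∀ u : H1 N, sobolevConst N * normLp (critExp N) u ^ 2 ≤ gradNorm u ^ 2 := by
  obtain ⟨κ, hκ, h⟩ := exists_normLp_critExp_le hN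
  obtain ⟨v, hv⟩ := exists_normLp_pos N (critExp_gt_two hN)
  set A := {S : ℝ | ∀ f : H1 N, S * normLp (critExp N) f ^ 2 ≤ gradNorm f ^ 2}
  have hmem : (κ ^ 2)⁻¹ ∈ A := fun f => by
    rw [inv_mul_le_iff₀ (by positivity), ← mul_pow]
    exact pow_le_pow_left₀ (normLp_nonneg _ _) (h f).2 2
  have hbdd : BddAbove A := ⟨gradNorm v ^ 2 / normLp (critExp N) v ^ 2, fun S hS => by
    rw [le_div_iff₀ (by positivity)]
    exact hS v⟩
  have hle : (κ ^ 2)⁻¹ ≤ sobolevConst N := le_csSup hbdd hmem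
  refine ⟨lt_of_lt_of_le (by positivity) hle, fun u => ?_⟩
  rcases (normLp_nonneg (critExp N) u).eq_or_lt with h0 | h0
  · rw [← h0]; simp; positivity
  · rw [← le_div_iff₀ (by positivity)]
    refine csSup_le ⟨_, hmem⟩ fun S hS => ?_
    rw [le_div_iff₀ (by positivity)]
    exact hS u

/-- Interpolating between `L²` and `L^(2^*)` and applying Sobolev shows that the set of admissible
constants is nonempty; its infimum is admissible because the inequality is closed in the constant.
Larger constants then follow by monotonicity. -/
theorem gagliardo_nirenberg (hN : 3 ≤ N) {q : ℝ} (hq : 2 < q) (hq' : q < 2 + 4 / N) {C : ℝ}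
    (hC : gnConst N q ≤ C) : 0 < C ∧ ∀ u : H1 N, normLp q u ≤
      C * gradNorm u ^ (N * (1 / 2 - 1 / q) : ℝ) * normLp 2 u ^ (1 - N * (1 / 2 - 1 / q) : ℝ) := by
  obtain ⟨κ, hκ, h⟩ := exists_normLp_critExp_le hN
  have h3 : (3 : ℝ) ≤ N := by exact_mod_cast hN
  have hr := lt_critExp hN hq'
  have h2 : 0 < critExp N - 2 := by linarith
  have hN2 : (N : ℝ) - 2 ≠ 0 := by linarith
  set A := {C : ℝ | 0 ≤ C ∧ ∀ f : H1 N, normLp q f ≤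
    C * gradNorm f ^ (N * (1 / 2 - 1 / q) : ℝ) * normLp 2 f ^ (1 - N * (1 / 2 - 1 / q) : ℝ)}
  have hmem : κ ^ (N * (1 / 2 - 1 / q) : ℝ) ∈ A := by
    refine ⟨by positivity, fun f => ?_⟩
    have hi := toReal_interpolation hq hr (Lp.memLp (fn f)) (h f).1
    rw [← normLp_eq_toReal, ← normLp_eq_toReal, ← Lp.norm_def, ← normLp_two] at hi
    have ha := normLp_nonneg 2 f
    have hb := normLp_nonneg (critExp N) f
    have hg := gradNorm_nonneg f
    have e1 : critExp N * ((q - 2) / (critExp N - 2)) = N * (1 / 2 - 1 / q) * q := by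
      have h4 : critExp N - 2 = 4 / (N - 2) := by rw [critExp]; field_simp; ring
      rw [h4, critExp]
      field_simp
      ring
    have e2 : 2 * ((critExp N - q) / (critExp N - 2)) = (1 - N * (1 / 2 - 1 / q)) * q := by
      have h4 : critExp N - 2 = 4 / (N - 2) := by rw [critExp]; field_simp; ring
      rw [h4, critExp]
      field_simp
      ring
    rw [← Real.rpow_two, ← Real.rpow_mul ha, ← Real.rpow_mul hb, e1, e2] at hi
    have hβ : 0 ≤ (N * (1 / 2 - 1 / q) : ℝ) := by
      have : 1 / q ≤ 1 / 2 := one_div_le_one_div_of_le two_pos hq.le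
      exact mul_nonneg (by linarith) (by linarith)
    have hi2 : normLp q f ^ q ≤ (κ ^ (N * (1 / 2 - 1 / q) : ℝ)
        * gradNorm f ^ (N * (1 / 2 - 1 / q) : ℝ) * normLp 2 f ^ (1 - N * (1 / 2 - 1 / q) : ℝ)) ^ q := by
      refine hi.trans ?_
      rw [← Real.mul_rpow hκ.le hg, Real.mul_rpow (by positivity) (by positivity),
        ← Real.rpow_mul (by positivity), ← Real.rpow_mul ha, mul_comm]
      gcongr
      exact (h f).2
    exact (Real.rpow_le_rpow_iff (normLp_nonneg _ _) (by positivity) (by linarith)).1 hi2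
  have hbdd : BddBelow A := ⟨0, fun S hS => hS.1⟩
  have hge : ∀ u : H1 N, normLp q u ≤ C * gradNorm u ^ (N * (1 / 2 - 1 / q) : ℝ)
      * normLp 2 u ^ (1 - N * (1 / 2 - 1 / q) : ℝ) := fun u => by
    have hg : 0 ≤ gradNorm u ^ (N * (1 / 2 - 1 / q) : ℝ)
        * normLp 2 u ^ (1 - N * (1 / 2 - 1 / q) : ℝ) :=
      mul_nonneg (Real.rpow_nonneg (gradNorm_nonneg u) _) (Real.rpow_nonneg (normLp_nonneg 2 u) _)
    rw [mul_assoc]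
    refine le_trans ?_ (mul_le_mul_of_nonneg_right hC hg)
    -- If the product of norms vanishes, one admissible constant already forces `normLp q u ≤ 0`;
    -- otherwise dividing by it turns every admissible constant into an upper bound for the
    -- quotient.
    rcases hg.eq_or_lt with h0 | h0
    · rw [← h0, mul_zero]
      have := hmem.2 u
      rwa [mul_assoc, ← h0, mul_zero] at this
    · rw [← div_le_iff₀ h0]
      refine le_csInf ⟨_, hmem⟩ fun S hS => ?_
      rw [div_le_iff₀ h0, ← mul_assoc]
      exact hS.2 u
  refine ⟨?_, hge⟩
  obtain ⟨v, hv⟩ := exists_normLp_pos N hq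
  by_contra hC0
  have h5 := hge v
  have hg : 0 ≤ gradNorm v ^ (N * (1 / 2 - 1 / q) : ℝ)
        * normLp 2 v ^ (1 - N * (1 / 2 - 1 / q) : ℝ) :=
      mul_nonneg (Real.rpow_nonneg (gradNorm_nonneg v) _) (Real.rpow_nonneg (normLp_nonneg 2 v) _)
  rw [mul_assoc] at h5
  nlinarith

/-- Functions of prescribed mass, with small gradient and negative energy. -/
theorem exists_energy_neg (hN : 3 ≤ N) {q : ℝ} (hq : 2 < q) (hq' : q < 2 + 4 / N) {μ : ℝ}
    (hμ : 0 < μ) {c ρ : ℝ} (hc : 0 < c) (hρ : 0 < ρ) :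
    ∃ u : H1 N, normLp 2 u ^ 2 = c ∧ gradNorm u ^ 2 < ρ ∧ energy q μ u < 0 := by
  obtain ⟨J₂, Jq, G, hJ₂, hJq, hG, h⟩ := exists_dilated_family N hq
  have h3 : (3 : ℝ) ≤ N := by exact_mod_cast hN
  -- This is mass-subcriticality: under dilation at fixed mass the Dirichlet term is `O(s²)`, and
  -- the `q`-term, of order `s^(N(q-2)/2)`, dominates it as `s → 0`.
  have he : 0 < 2 - N * (q - 2) / 2 := by
    have : (q - 2) * N < 4 := by
      rw [← lt_div_iff₀ (by linarith)]; linarith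
    linarith
  set k := μ / q * ((c / J₂) ^ (q / 2) * Jq) with hk
  have hk0 : 0 < k := by positivity
  have ht1 : Tendsto (fun s : ℝ => c * G / J₂ * s ^ 2) (𝓝[>] 0) (𝓝 0) := by
    have : Continuous fun s : ℝ => c * G / J₂ * s ^ 2 := by fun_prop
    simpa using (this.tendsto 0).mono_left nhdsWithin_le_nhds
  have ht2 : Tendsto (fun s : ℝ => c * G / J₂ * s ^ (2 - N * (q - 2) / 2)) (𝓝[>] 0) (𝓝 0) := by
    have h0 := ((Real.continuousAt_rpow_const 0 _ (Or.inr he.le)).tendsto.const_mul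
      (c * G / J₂)).mono_left (nhdsWithin_le_nhds (s := Ioi 0))
    rwa [Real.zero_rpow he.ne', mul_zero] at h0
  obtain ⟨s, ⟨hs1, hs2⟩, hs0⟩ := (((ht1.eventually_lt_const hρ).and
    (ht2.eventually_lt_const hk0)).and self_mem_nhdsWithin).exists
  replace hs0 : 0 < s := hs0
  obtain ⟨u, hu2, huq, hug⟩ := h s hs0
  -- The amplitude restoring mass `c` after dilation by `s`.
  set θ := √(c * s ^ N / J₂) with hθ
  have hθ2 : θ ^ 2 = c * s ^ N / J₂ := Real.sq_sqrt (by positivity)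
  have hn : ‖(θ : ℂ)‖ = θ := by rw [Complex.norm_real, Real.norm_of_nonneg (Real.sqrt_nonneg _)]
  have hsN : s ^ N ≠ 0 := by positivity
  have hgr : gradNorm ((θ : ℂ) • u) ^ 2 = c * G / J₂ * s ^ 2 := by
    rw [gradNorm_smul, hn, mul_pow, hθ2, hug]
    field_simp
  refine ⟨(θ : ℂ) • u, ?_, hgr ▸ hs1, ?_⟩
  · rw [normLp_smul, hn, mul_pow, hθ2, hu2]
    field_simp
  · have hq3 : normLp q ((θ : ℂ) • u) ^ q
        = (c / J₂) ^ (q / 2) * Jq * s ^ (N * (q - 2) / 2 : ℝ) := by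
      rw [normLp_smul, hn, Real.mul_rpow (Real.sqrt_nonneg _) (normLp_nonneg _ _), huq]
      have e1 : θ ^ q = (θ ^ 2) ^ (q / 2) := by
        rw [← Real.rpow_two, ← Real.rpow_mul (Real.sqrt_nonneg _)]
        congr 1; ring
      have e2 : (N * (q - 2) / 2 : ℝ) = N * (q / 2) - N := by ring
      rw [e1, hθ2, mul_div_right_comm, Real.mul_rpow (by positivity) (by positivity), e2,
        Real.rpow_sub hs0, Real.rpow_natCast, Real.rpow_mul hs0.le, Real.rpow_natCast]
      field_simp
    have e3 : s ^ 2 = s ^ (2 - N * (q - 2) / 2 : ℝ) * s ^ (N * (q - 2) / 2 : ℝ) := by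
      rw [← Real.rpow_add hs0, sub_add_cancel, Real.rpow_two]
    have hp : 0 ≤ 1 / critExp N * normLp (critExp N) ((θ : ℂ) • u) ^ critExp N := by
      have := critExp_gt_two hN
      exact mul_nonneg (by positivity) (Real.rpow_nonneg (normLp_nonneg _ _) _)
    have hsp : 0 < s ^ (N * (q - 2) / 2 : ℝ) := Real.rpow_pos_of_pos hs0 _
    have e4 : μ / q * ((c / J₂) ^ (q / 2) * Jq * s ^ (N * (q - 2) / 2 : ℝ))
        = k * s ^ (N * (q - 2) / 2 : ℝ) := by rw [hk]; ring
    rw [energy, hgr, hq3, e4, e3, ← mul_assoc]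
    have h7 := mul_lt_mul_of_pos_right hs2 hsp
    have h8 : 0 < k * s ^ (N * (q - 2) / 2 : ℝ) := by positivity
    linarith

/-! ### The energy inside the gradient ball and its comparison with the infimum. -/

section LocalEnergy

variable {q μ C : ℝ}

theorem alpha0_neg (hN : 3 ≤ N) (hq' : q < 2 + 4 / N) : alpha0 N q < 0 := by
  have h3 : (3 : ℝ) ≤ N := by exact_mod_cast hN
  have : (q - 2) * N < 4 := by
    rw [← lt_div_iff₀ (by linarith)]; linarith
  rw [alpha0]; linarith

theorem alpha2_pos (hN : 3 ≤ N) : 0 < alpha2 N := by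
  have h3 : (3 : ℝ) ≤ N := by exact_mod_cast hN
  exact div_pos (by norm_num) (by linarith)

theorem alpha1_pos (hN : 3 ≤ N) (hq' : q < 2 + 4 / N) : 0 < alpha1 N q := by
  have h3 : (3 : ℝ) ≤ N := by exact_mod_cast hN
  have h := lt_critExp hN hq'
  rw [critExp, lt_div_iff₀ (by linarith)] at h
  rw [alpha1]; linarith

theorem alpha0_add_alpha1 : alpha0 N q + alpha1 N q = q - 2 := by
  rw [alpha0, alpha1]; ring

/-- This is the power of the mass carried by both terms of the threshold function at `ρ = ρ_c`; it
is inverse to the exponent `N/2` in `c0`. -/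
theorem alpha1_mul_alpha2_div (hN : 3 ≤ N) (hq' : q < 2 + 4 / N) :
    alpha1 N q * alpha2 N / (2 * (alpha2 N - alpha0 N q)) = 2 / N := by
  have h3 : (3 : ℝ) ≤ N := by exact_mod_cast hN
  have hN2 : (N : ℝ) - 2 ≠ 0 := by linarith
  have hN0 : (N : ℝ) ≠ 0 := by linarith
  have h1 := (alpha1_pos hN hq').ne'
  have hD : alpha2 N - alpha0 N q = N * alpha1 N q / (N - 2) := by
    rw [alpha0, alpha1, alpha2]; field_simp; ring
  rw [hD, alpha2]
  field_simp
  norm_num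

theorem critExp_eq (hN : 3 ≤ N) : critExp N = 2 + alpha2 N := by
  have h3 : (3 : ℝ) ≤ N := by exact_mod_cast hN
  have hN2 : (N : ℝ) - 2 ≠ 0 := by linarith
  rw [critExp, alpha2]; field_simp; ring

/-- The coefficient `(μ/q) C^q`. -/
noncomputable def coefA (q μ C : ℝ) : ℝ := μ / q * C ^ q

/-- The coefficient `(1/2^*) S^(-2^*/2)`. -/
noncomputable def coefB (N : ℕ) : ℝ := 1 / critExp N * (1 / sobolevConst N ^ (critExp N / 2))

theorem coefA_pos (hq : 2 < q) (hμ : 0 < μ) (hC : 0 < C) : 0 < coefA q μ C := by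
  rw [coefA]; positivity

theorem coefB_pos (hN : 3 ≤ N) : 0 < coefB N := by
  have h1 := critExp_gt_two hN
  have h2 := (sobolevConst_spec hN).1
  rw [coefB]; positivity

theorem bracket_pos (hN : 3 ≤ N) (hq : 2 < q) (hq' : q < 2 + 4 / N) (hμ : 0 < μ) (hC : 0 < C) :
    0 < bracket N q μ C := by
  have h0 := alpha0_neg hN hq'
  have h2 := alpha2_pos hN
  have hS := (sobolevConst_spec hN).1
  have hc := critExp_gt_two hN
  have : 0 < -(alpha0 N q / alpha2 N) := neg_pos.2 (div_neg_of_neg_of_pos h0 h2)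
  rw [bracket]; positivity

theorem constK_eq : constK N q μ C
    = coefA q μ C * bracket N q μ C ^ (alpha0 N q / (alpha2 N - alpha0 N q))
      + coefB N * bracket N q μ C ^ (alpha2 N / (alpha2 N - alpha0 N q)) := rfl

theorem constK_pos (hN : 3 ≤ N) (hq : 2 < q) (hq' : q < 2 + 4 / N) (hμ : 0 < μ) (hC : 0 < C) :
    0 < constK N q μ C := by
  have := bracket_pos hN hq hq' hμ hC
  have := coefA_pos hq hμ hC
  have := coefB_pos hN
  rw [constK_eq]; positivity

theorem c0_pos (hN : 3 ≤ N) (hq : 2 < q) (hq' : q < 2 + 4 / N) (hμ : 0 < μ) (hC : 0 < C) :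
    0 < c0 N q μ C := by
  have := constK_pos hN hq hq' hμ hC
  rw [c0]; positivity

theorem rho0_pos (hN : 3 ≤ N) (hq : 2 < q) (hq' : q < 2 + 4 / N) (hμ : 0 < μ) (hC : 0 < C) :
    0 < rho0 N q μ C := by
  have := bracket_pos hN hq hq' hμ hC
  have := c0_pos hN hq hq' hμ hC
  rw [rho0, rhoAt]; positivity

/-- At `ρ = ρ_c` both terms are multiples of `c^(2/N)` and their sum is `K c^(2/N)`, so the equation
is the definition of `c₀`. -/
theorem threshold_eq (hN : 3 ≤ N) (hq : 2 < q) (hq' : q < 2 + 4 / N) (hμ : 0 < μ) (hC : 0 < C) :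
    coefA q μ C * rho0 N q μ C ^ (alpha0 N q / 2) * c0 N q μ C ^ (alpha1 N q / 2)
      + coefB N * rho0 N q μ C ^ (alpha2 N / 2) = 1 / 2 := by
  have hA := bracket_pos hN hq hq' hμ hC
  have hc := c0_pos hN hq hq' hμ hC
  have hK := constK_pos hN hq hq' hμ hC
  have h0 := alpha0_neg hN hq'
  have h2 := alpha2_pos hN
  have h3 : (3 : ℝ) ≤ N := by exact_mod_cast hN
  have hD : alpha2 N - alpha0 N q ≠ 0 := by linarith
  have he := alpha1_mul_alpha2_div hN hq'
  have hc2 : c0 N q μ C ^ (2 / N : ℝ) = 1 / (2 * constK N q μ C) := by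
    rw [c0, ← Real.rpow_mul (by positivity), div_mul_div_comm, mul_comm (N : ℝ) 2, div_self,
      Real.rpow_one]
    positivity
  have hr : ∀ t : ℝ, rho0 N q μ C ^ (t / 2) = bracket N q μ C ^ (t / (alpha2 N - alpha0 N q))
      * c0 N q μ C ^ (alpha1 N q * t / (2 * (alpha2 N - alpha0 N q))) := fun t => by
    rw [rho0, rhoAt, Real.mul_rpow (by positivity) (by positivity), ← Real.rpow_mul hA.le,
      ← Real.rpow_mul hc.le]
    congr 2 <;> field_simp
  have e1 : alpha1 N q * alpha0 N q / (2 * (alpha2 N - alpha0 N q)) + alpha1 N q / 2 = 2 / N := by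
    rw [← he]; field_simp; ring
  rw [hr, hr, he, hc2, mul_assoc (coefA q μ C), mul_assoc _ _ (c0 N q μ C ^ _),
    ← Real.rpow_add hc, e1, hc2, ← mul_assoc, ← mul_assoc, ← add_mul, ← constK_eq]
  field_simp

/-- The coercivity constant `1/2 - (1/2^*) S^(-2^*/2) ρ₀^(α₂/2)`. -/
theorem coefB_mul_rho0_lt (hN : 3 ≤ N) (hq : 2 < q) (hq' : q < 2 + 4 / N) (hμ : 0 < μ)
    (hC : 0 < C) : coefB N * rho0 N q μ C ^ (alpha2 N / 2) < 1 / 2 := by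
  have := threshold_eq hN hq hq' hμ hC
  have := coefA_pos hq hμ hC
  have := rho0_pos hN hq hq' hμ hC
  have := c0_pos hN hq hq' hμ hC
  have : 0 < coefA q μ C * rho0 N q μ C ^ (alpha0 N q / 2) * c0 N q μ C ^ (alpha1 N q / 2) := by
    positivity
  linarith

/-- The Gagliardo–Nirenberg inequality to the power `q`, with `βq = 2 + α₀` and `(1-β)q = α₁`. -/
theorem subcritical_term_le (hN : 3 ≤ N) (hq : 2 < q) (hq' : q < 2 + 4 / N) (hμ : 0 < μ)
    (hC : gnConst N q ≤ C) (u : H1 N) : μ / q * normLp q u ^ q ≤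
      coefA q μ C * (gradNorm u ^ 2) ^ (1 + alpha0 N q / 2)
        * (normLp 2 u ^ 2) ^ (alpha1 N q / 2) := by
  obtain ⟨hC0, h⟩ := gagliardo_nirenberg hN hq hq' hC
  have ha := normLp_nonneg 2 u
  have hg := gradNorm_nonneg u
  have h1 := Real.rpow_le_rpow (normLp_nonneg q u) (h u) (by linarith : 0 ≤ q)
  rw [Real.mul_rpow (by positivity) (by positivity), Real.mul_rpow (by positivity) (by positivity),
    ← Real.rpow_mul hg, ← Real.rpow_mul ha] at h1
  have e1 : (N * (1 / 2 - 1 / q) * q : ℝ) = 2 * (1 + alpha0 N q / 2) := by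
    rw [alpha0]; field_simp; ring
  have e2 : ((1 - N * (1 / 2 - 1 / q)) * q : ℝ) = 2 * (alpha1 N q / 2) := by
    rw [alpha1]; field_simp; ring
  rw [e1, e2, Real.rpow_mul hg, Real.rpow_mul ha, Real.rpow_two, Real.rpow_two] at h1
  have h2 := mul_le_mul_of_nonneg_left h1 (by positivity : 0 ≤ μ / q)
  rw [coefA]
  linarith

theorem critical_term_le (hN : 3 ≤ N) (u : H1 N) :
    1 / critExp N * normLp (critExp N) u ^ critExp N
      ≤ coefB N * (gradNorm u ^ 2) ^ (1 + alpha2 N / 2) := by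
  obtain ⟨hS, h⟩ := sobolevConst_spec hN
  have hc := critExp_gt_two hN
  have hr := normLp_nonneg (critExp N) u
  have h1 := Real.rpow_le_rpow (by positivity) (h u) (by linarith : 0 ≤ critExp N / 2)
  rw [Real.mul_rpow hS.le (by positivity), ← Real.rpow_natCast, ← Real.rpow_mul hr] at h1
  have e1 : ((2 : ℕ) : ℝ) * (critExp N / 2) = critExp N := by push_cast; ring
  have e2 : critExp N / 2 = 1 + alpha2 N / 2 := by rw [critExp_eq hN]; ring
  rw [e1] at h1
  have hS' : 0 < sobolevConst N ^ (critExp N / 2) := by positivity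
  rw [coefB, mul_assoc, ← e2, one_div_mul_eq_div (sobolevConst N ^ (critExp N / 2))]
  gcongr
  rw [le_div_iff₀ hS', mul_comm]
  exact h1

/-- One factor `‖∇u‖²` is kept and the remaining power is bounded by the radius, so the critical
term becomes a multiple of the Dirichlet term. -/
theorem critical_term_le_of_le (hN : 3 ≤ N) {ρ : ℝ} {u : H1 N} (hu : gradNorm u ^ 2 ≤ ρ) :
    1 / critExp N * normLp (critExp N) u ^ critExp N
      ≤ coefB N * ρ ^ (alpha2 N / 2) * gradNorm u ^ 2 := by
  have h2 := alpha2_pos hN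
  have hb := coefB_pos hN
  refine (critical_term_le hN u).trans ?_
  have h0 : 0 ≤ gradNorm u ^ 2 := by positivity
  rw [Real.rpow_add_of_nonneg h0 zero_le_one (by positivity), Real.rpow_one, mul_assoc,
    mul_comm (gradNorm u ^ 2)]
  gcongr

/-- Coercivity of the energy on `B_{ρ₀}`, up to the subcritical term. -/
theorem energy_ge (hN : 3 ≤ N) {ρ : ℝ} {u : H1 N} (hu : gradNorm u ^ 2 ≤ ρ) :
    (1 / 2 - coefB N * ρ ^ (alpha2 N / 2)) * gradNorm u ^ 2 - μ / q * normLp q u ^ q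
      ≤ energy q μ u := by
  have := critical_term_le_of_le hN hu
  rw [energy]
  linarith

/-- After division by `X = ‖∇u‖²` only `X^(α₀/2) m^(α₁/2)` needs control. As `α₀ < 0`, the worst
case is `X = (m/c) ρ₀`, where it equals `(m/c)^((q-2)/2) ρ₀^(α₀/2) c^(α₁/2)` because `α₀ + α₁ = q -
2`; this is below the value at `c₀`, and `threshold_eq` concludes. Contrapositively, negative energy
confines `u` to a ball small enough for rescaling to mass `c` to remain in `B_{ρ₀}`. -/
theorem energy_nonneg_of_gradNorm (hN : 3 ≤ N) (hq : 2 < q) (hq' : q < 2 + 4 / N) (hμ : 0 < μ)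
    (hC : gnConst N q ≤ C) {c : ℝ} (hc : c < c0 N q μ C) {u : H1 N} (hm : 0 < normLp 2 u ^ 2)
    (hmc : normLp 2 u ^ 2 ≤ c) (hu : gradNorm u ^ 2 ≤ rho0 N q μ C)
    (hu' : normLp 2 u ^ 2 / c * rho0 N q μ C ≤ gradNorm u ^ 2) : 0 ≤ energy q μ u := by
  have hC0 := (gagliardo_nirenberg hN hq hq' hC).1
  have hρ := rho0_pos hN hq hq' hμ hC0
  have hA := coefA_pos hq hμ hC0
  have hc0 : 0 < c := hm.trans_le hmc
  have ha0 := alpha0_neg hN hq'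
  have ha1 := alpha1_pos hN hq'
  have hs := subcritical_term_le hN hq hq' hμ hC u
  have ht := threshold_eq hN hq hq' hμ hC0
  have he := energy_ge (q := q) (μ := μ) hN hu
  set m := normLp 2 u ^ 2
  set X := gradNorm u ^ 2
  set ρ := rho0 N q μ C
  have hX : 0 < X := lt_of_lt_of_le (by positivity) hu'
  have key : X ^ (alpha0 N q / 2) * m ^ (alpha1 N q / 2)
      ≤ ρ ^ (alpha0 N q / 2) * c0 N q μ C ^ (alpha1 N q / 2) := by
    calc X ^ (alpha0 N q / 2) * m ^ (alpha1 N q / 2)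
        ≤ (m / c * ρ) ^ (alpha0 N q / 2) * m ^ (alpha1 N q / 2) :=
          mul_le_mul_of_nonneg_right
            (Real.rpow_le_rpow_of_nonpos (by positivity) hu' (by linarith)) (by positivity)
      _ = (m / c) ^ ((q - 2) / 2) * (ρ ^ (alpha0 N q / 2) * c ^ (alpha1 N q / 2)) := by
          have e : m ^ (alpha1 N q / 2) = (m / c) ^ (alpha1 N q / 2) * c ^ (alpha1 N q / 2) := by
            rw [← Real.mul_rpow (by positivity) hc0.le, div_mul_cancel₀ _ hc0.ne']
          rw [e, Real.mul_rpow (by positivity) hρ.le, ← alpha0_add_alpha1 (N := N), add_div,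
            Real.rpow_add (by positivity)]
          ring
      _ ≤ 1 * (ρ ^ (alpha0 N q / 2) * c ^ (alpha1 N q / 2)) := by
          gcongr
          exact Real.rpow_le_one (by positivity) ((div_le_one hc0).2 hmc) (by linarith)
      _ ≤ ρ ^ (alpha0 N q / 2) * c0 N q μ C ^ (alpha1 N q / 2) := by
          rw [one_mul]; gcongr
  have hs2 : μ / q * normLp q u ^ q
      ≤ X * (coefA q μ C * (ρ ^ (alpha0 N q / 2) * c0 N q μ C ^ (alpha1 N q / 2))) := by
    refine hs.trans ?_
    rw [Real.rpow_add hX, Real.rpow_one]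
    have := mul_le_mul_of_nonneg_left key (by positivity : 0 ≤ X * coefA q μ C)
    linarith
  have h5 : X * (coefA q μ C * (ρ ^ (alpha0 N q / 2) * c0 N q μ C ^ (alpha1 N q / 2)))
      = X * (1 / 2 - coefB N * ρ ^ (alpha2 N / 2)) := by rw [← ht]; ring
  linarith

/-- The coercive part is dropped and the subcritical term is bounded on the ball. Boundedness is
what makes the real `sInf` a genuine lower bound. -/
theorem bddBelow_energy (hN : 3 ≤ N) (hq : 2 < q) (hq' : q < 2 + 4 / N) (hμ : 0 < μ)
    (hC : gnConst N q ≤ C) (c : ℝ) : BddBelow (energy q μ '' localSet N q μ C c) := by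
  have hC0 := (gagliardo_nirenberg hN hq hq' hC).1
  have hA := coefA_pos hq hμ hC0
  have hb := coefB_mul_rho0_lt hN hq hq' hμ hC0
  -- The exponent equals `N(q-2)/4`.
  have h0 : 0 ≤ 1 + alpha0 N q / 2 := by
    have h3 : (3 : ℝ) ≤ N := by exact_mod_cast hN
    have : 0 ≤ N * (q - 2) := mul_nonneg (by linarith) (by linarith)
    rw [alpha0]; linarith
  refine ⟨-(coefA q μ C * rho0 N q μ C ^ (1 + alpha0 N q / 2) * c ^ (alpha1 N q / 2)), ?_⟩
  rintro _ ⟨u, ⟨hu1, hu2⟩, rfl⟩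
  have hu1 : normLp 2 u ^ 2 = c := hu1
  have hu2 : gradNorm u ^ 2 < rho0 N q μ C := hu2
  have he := energy_ge (q := q) (μ := μ) hN hu2.le
  have hs := subcritical_term_le hN hq hq' hμ hC u
  rw [hu1] at hs
  have hc : 0 ≤ c := hu1 ▸ sq_nonneg _
  have h1 : coefA q μ C * (gradNorm u ^ 2) ^ (1 + alpha0 N q / 2) * c ^ (alpha1 N q / 2)
      ≤ coefA q μ C * rho0 N q μ C ^ (1 + alpha0 N q / 2) * c ^ (alpha1 N q / 2) := by gcongr
  have h2 : 0 ≤ (1 / 2 - coefB N * rho0 N q μ C ^ (alpha2 N / 2)) * gradNorm u ^ 2 :=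
    mul_nonneg (by linarith) (sq_nonneg _)
  linarith

theorem infEnergy_le (hN : 3 ≤ N) (hq : 2 < q) (hq' : q < 2 + 4 / N) (hμ : 0 < μ)
    (hC : gnConst N q ≤ C) {c : ℝ} {u : H1 N} (hu : u ∈ localSet N q μ C c) :
    infEnergy N q μ C c ≤ energy q μ u :=
  csInf_le (bddBelow_energy hN hq hq' hμ hC c) ⟨u, hu, rfl⟩

theorem infEnergy_neg (hN : 3 ≤ N) (hq : 2 < q) (hq' : q < 2 + 4 / N) (hμ : 0 < μ)
    (hC : gnConst N q ≤ C) {c : ℝ} (hc : 0 < c) : infEnergy N q μ C c < 0 := by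
  obtain ⟨u, h1, h2, h3⟩ := exists_energy_neg hN hq hq' hμ hc
    (rho0_pos hN hq hq' hμ (gagliardo_nirenberg hN hq hq' hC).1)
  exact (infEnergy_le hN hq hq' hμ hC ⟨h1, h2⟩).trans_lt h3

theorem normLp_pos_of_mass_pos (hN : 3 ≤ N) (hq : 2 < q) (hq' : q < 2 + 4 / N) {u : H1 N}
    (hu : 0 < normLp 2 u) : 0 < normLp q u := by
  refine (normLp_nonneg q u).lt_of_ne fun h => hu.ne' ?_
  rw [normLp_eq_toReal, eq_comm, ENNReal.toReal_eq_zero_iff,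
    eLpNorm_eq_zero_iff (Lp.aestronglyMeasurable _) (by simp; linarith)] at h
  have h1 := h.resolve_right (memLp_subcritical hN hq hq' u).2.ne
  rw [normLp_eq_toReal, eLpNorm_congr_ae h1]
  simp

/-- Both nonlinear terms grow at least like `θ²`. The gain from the critical one is discarded; the
gain from the subcritical one is kept, as it provides strictness below. -/
theorem energy_smul_le (hN : 3 ≤ N) {θ : ℝ} (hθ : 1 ≤ θ) (u : H1 N) :
    energy q μ ((θ : ℂ) • u)
      ≤ θ ^ 2 * energy q μ u - μ / q * (θ ^ q - θ ^ 2) * normLp q u ^ q := by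
  have hc := critExp_gt_two hN
  have hn : ‖(θ : ℂ)‖ = θ := by rw [Complex.norm_real, Real.norm_of_nonneg (by linarith)]
  have h0 : 0 ≤ θ := by linarith
  have h1 : θ ^ 2 ≤ θ ^ critExp N := by
    rw [← Real.rpow_two]; exact Real.rpow_le_rpow_of_exponent_le hθ hc.le
  have hR : 0 ≤ normLp (critExp N) u ^ critExp N := Real.rpow_nonneg (normLp_nonneg _ _) _
  have h2 : 1 / critExp N * (θ ^ 2 * normLp (critExp N) u ^ critExp N)
      ≤ 1 / critExp N * (θ ^ critExp N * normLp (critExp N) u ^ critExp N) := by gcongr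
  rw [energy, energy, gradNorm_smul, normLp_smul, normLp_smul, hn,
    Real.mul_rpow h0 (normLp_nonneg _ _), Real.mul_rpow h0 (normLp_nonneg _ _)]
  linarith

/-- Amplitude scaling to mass `c` gives a lower bound linear in the mass, which plays the role of
strict subadditivity of `m`. It is stated for the closed ball because weak limits and remainders are
only known to lie there. -/
theorem infEnergy_mul_le (hN : 3 ≤ N) (hq : 2 < q) (hq' : q < 2 + 4 / N) (hμ : 0 < μ)
    (hC : gnConst N q ≤ C) {c : ℝ} (hc : c < c0 N q μ C) {u : H1 N} (hm : 0 < normLp 2 u ^ 2)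
    (hmc : normLp 2 u ^ 2 ≤ c) (hu : gradNorm u ^ 2 ≤ rho0 N q μ C) :
    normLp 2 u ^ 2 / c * infEnergy N q μ C c ≤ energy q μ u ∧
      (normLp 2 u ^ 2 < c → normLp 2 u ^ 2 / c * infEnergy N q μ C c < energy q μ u) := by
  have hc0 : 0 < c := hm.trans_le hmc
  have hneg := infEnergy_neg (C := C) hN hq hq' hμ hC hc0
  -- Nonnegative energy is immediate since `m(c) < 0`; negative energy places the rescaled function
  -- in the open ball.
  rcases le_or_gt 0 (energy q μ u) with h0 | h0
  · have : normLp 2 u ^ 2 / c * infEnergy N q μ C c < 0 := mul_neg_of_pos_of_neg (by positivity) hneg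
    exact ⟨by linarith, fun _ => by linarith⟩
  have hX : gradNorm u ^ 2 < normLp 2 u ^ 2 / c * rho0 N q μ C := by
    by_contra hcon
    exact h0.not_ge (energy_nonneg_of_gradNorm hN hq hq' hμ hC hc hm hmc hu (not_lt.1 hcon))
  set m := normLp 2 u ^ 2
  set θ := √(c / m) with hθ
  have hθ2 : θ ^ 2 = c / m := Real.sq_sqrt (by positivity)
  have hθ1 : 1 ≤ θ := Real.one_le_sqrt.2 ((one_le_div hm).2 hmc)
  have hn : ‖(θ : ℂ)‖ = θ := by rw [Complex.norm_real, Real.norm_of_nonneg (by linarith)]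
  have hV : (θ : ℂ) • u ∈ localSet N q μ C c := by
    refine ⟨?_, ?_⟩
    · change normLp 2 ((θ : ℂ) • u) ^ 2 = c
      rw [normLp_smul, hn, mul_pow, hθ2]
      exact div_mul_cancel₀ _ hm.ne'
    · change gradNorm ((θ : ℂ) • u) ^ 2 < rho0 N q μ C
      rw [gradNorm_smul, hn, mul_pow, hθ2]
      calc c / m * gradNorm u ^ 2 < c / m * (m / c * rho0 N q μ C) := by gcongr
        _ = rho0 N q μ C := by field_simp
  have h1 := (infEnergy_le hN hq hq' hμ hC hV).trans (energy_smul_le hN hθ1 u)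
  rw [hθ2] at h1
  have hP : 0 < normLp q u := normLp_pos_of_mass_pos hN hq hq'
    ((normLp_nonneg 2 u).lt_of_ne fun h => by simp [m, ← h] at hm)
  have hPq : 0 < normLp q u ^ q := by positivity
  have hθq : c / m ≤ θ ^ q := by
    rw [← hθ2, ← Real.rpow_two]; exact Real.rpow_le_rpow_of_exponent_le hθ1 hq.le
  have hid : m / c * (c / m * energy q μ u) = energy q μ u := by field_simp
  constructor
  · have h2 : 0 ≤ μ / q * (θ ^ q - c / m) * normLp q u ^ q :=
      mul_nonneg (mul_nonneg (by positivity) (by linarith)) hPq.le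
    rw [← hid]
    gcongr
    linarith
  · intro hlt
    have hθ1' : 1 < θ := by
      rw [hθ, Real.lt_sqrt zero_le_one]
      simpa using (one_lt_div hm).2 hlt
    have hθq' : c / m < θ ^ q := by
      rw [← hθ2, ← Real.rpow_two]; exact Real.rpow_lt_rpow_of_exponent_lt hθ1' hq
    have h2 : 0 < μ / q * (θ ^ q - c / m) * normLp q u ^ q :=
      mul_pos (mul_pos (by positivity) (by linarith)) hPq
    rw [← hid]
    gcongr
    linarith

end LocalEnergy

/-! ### Nonvanishing through mollifications. -/

/-- A continuous compactly supported real function, as an element of `L²(ℝ^N, ℂ)`. -/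
noncomputable def testL2 (ψ : Eucl N → ℝ) (hψ : Continuous ψ) (hc : HasCompactSupport ψ) : L2 N :=
  MemLp.toLp (fun x => (ψ x : ℂ)) ((Complex.continuous_ofReal.comp hψ).memLp_of_hasCompactSupport
    (hc.comp_left Complex.ofReal_zero))

theorem inner_testL2 {ψ : Eucl N → ℝ} (hψ : Continuous ψ) (hc : HasCompactSupport ψ) (u : L2 N) :
    inner ℂ (testL2 ψ hψ hc) u = ∫ x, ψ x • u x := by
  rw [L2.inner_def]
  refine integral_congr_ae ?_
  filter_upwards [MemLp.coeFn_toLp ((Complex.continuous_ofReal.comp hψ).memLp_of_hasCompactSupport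
    (μ := volume) (p := 2) (hc.comp_left Complex.ofReal_zero))] with x hx
  change inner ℂ (testL2 ψ hψ hc x) (u x) = ψ x • u x
  have hx' : testL2 ψ hψ hc x = (ψ x : ℂ) := hx
  rw [hx', RCLike.inner_apply]
  simp [mul_comm]

/-- A point value of a mollification is an `L²` pairing with a kernel whose norm does not depend on
the point. This gives a uniform sup bound, and pointwise convergence under weak convergence. -/
theorem moll_eq_inner (φ : ContDiffBump (0 : Eucl N)) (x : Eucl N) :
    ∃ k : L2 N, ‖k‖ = (eLpNorm (φ.normed volume) 2 volume).toReal ∧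
      ∀ u : L2 N, moll φ u x = inner ℂ k u := by
  have hc : HasCompactSupport fun t => φ.normed volume (x - t) :=
    φ.hasCompactSupport_normed.comp_homeomorph (Homeomorph.subLeft x)
  have hcont : Continuous fun t => φ.normed volume (x - t) :=
    φ.continuous_normed.comp (by fun_prop)
  refine ⟨testL2 (fun t => φ.normed volume (x - t)) hcont hc, ?_, fun u => ?_⟩
  · rw [testL2, Lp.norm_toLp]
    congr 1
    have h1 : eLpNorm (fun t => ((φ.normed volume (x - t) : ℝ) : ℂ)) 2 volume
        = eLpNorm (fun t => φ.normed volume (x - t)) 2 volume :=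
      eLpNorm_congr_norm_ae (Eventually.of_forall fun t => by simp)
    rw [h1]
    exact eLpNorm_comp_measurePreserving (g := φ.normed volume) (f := fun t => x - t)
      (μ := volume) (ν := volume) φ.continuous_normed.aestronglyMeasurable
      (Measure.measurePreserving_sub_left volume x)
  · rw [inner_testL2, moll_apply_swap]

theorem norm_moll_le (φ : ContDiffBump (0 : Eucl N)) (u : L2 N) (x : Eucl N) :
    ‖moll φ u x‖ ≤ (eLpNorm (φ.normed volume) 2 volume).toReal * ‖u‖ := by
  obtain ⟨k, hk, h⟩ := moll_eq_inner φ x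
  rw [h, ← hk]
  exact norm_inner_le_norm k u

theorem moll_shift (φ : ContDiffBump (0 : Eucl N)) (y : Eucl N) (u : H1 N) (x : Eucl N) :
    moll φ (fn (shift y u)) x = moll φ (fn u) (x - y) := by
  rw [moll_apply_swap, moll_apply]
  have h1 : ∫ t, φ.normed volume (x - t) • fn (shift y u) t
      = ∫ t, φ.normed volume (x - t) • fn u (t - y) :=
    integral_congr_ae ((fn_shift_ae y u).mono fun t ht => by simp only [ht])
  rw [h1, ← integral_sub_left_eq_self _ volume x]
  refine integral_congr_ae (Eventually.of_forall fun t => ?_)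
  change φ.normed volume (x - (x - t)) • fn u (x - t - y) = _
  rw [sub_sub_cancel, sub_right_comm]

theorem toReal_eLpNorm_sub_moll_le (φ : ContDiffBump (0 : Eucl N)) (u : H1 N) :
    (eLpNorm (fun x => fn u x - moll φ (fn u) x) 2 volume).toReal ≤ φ.rOut * gradNorm u := by
  have h := eLpNorm_sub_moll_le φ (Lp.stronglyMeasurable (fn u))
    ((Lp.memLp (fn u)).locallyIntegrable (by norm_num)) (Lp.stronglyMeasurable (grad u))
    ((Lp.memLp (grad u)).locallyIntegrable (by norm_num)) u.2
  have h1 := ENNReal.toReal_mono (ENNReal.mul_ne_top ENNReal.ofReal_ne_top (Lp.memLp _).2.ne) h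
  rwa [ENNReal.toReal_mul, ENNReal.toReal_ofReal φ.rOut_pos.le, ← Lp.norm_def] at h1

theorem continuous_moll (φ : ContDiffBump (0 : Eucl N)) (u : H1 N) :
    Continuous (moll φ (fn u)) :=
  (contDiff_moll φ ((Lp.memLp (fn u)).locallyIntegrable (by norm_num))).continuous

theorem memLp_moll (φ : ContDiffBump (0 : Eucl N)) (u : H1 N) {p : ℝ≥0∞} (hp : 1 ≤ p)
    (hp' : p ≠ ⊤) (hu : MemLp (fn u) p volume) : MemLp (moll φ (fn u)) p volume :=
  ⟨(continuous_moll φ u).aestronglyMeasurable,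
    (eLpNorm_moll_le φ (Lp.stronglyMeasurable _) hp hp').trans_lt hu.2⟩

/-- Mollification error in a subcritical Lebesgue norm. -/
theorem sub_moll_subcritical_le (hN : 3 ≤ N) {q : ℝ} (hq : 2 < q) (hq' : q < 2 + 4 / N)
    {κ M : ℝ} (hκ : ∀ u : H1 N, normLp (critExp N) u ≤ κ * gradNorm u) (hκ0 : 0 < κ)
    (φ : ContDiffBump (0 : Eucl N)) {u : H1 N} (hu : gradNorm u ≤ M) :
    (eLpNorm (fun x => fn u x - moll φ (fn u) x) (ENNReal.ofReal q) volume).toReal ^ q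
      ≤ ((φ.rOut * M) ^ 2) ^ ((critExp N - q) / (critExp N - 2))
        * ((2 * (κ * M)) ^ critExp N) ^ ((q - 2) / (critExp N - 2)) := by
  have hr := lt_critExp hN hq'
  have hr1 : 1 ≤ ENNReal.ofReal (critExp N) := by simp; linarith
  have hM : 0 ≤ M := (gradNorm_nonneg u).trans hu
  have h2 := Lp.memLp (fn u)
  have hc := memLp_critExp hN u
  have hm2 := memLp_moll φ u (by norm_num) (by norm_num) h2
  have hmc := memLp_moll φ u hr1 ENNReal.ofReal_ne_top hc
  have h0 : 0 < critExp N - 2 := by linarith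
  -- The error is small in `L²`, of size `rOut * M`, and merely bounded in the critical norm;
  -- interpolation makes it small in `L^q`.
  refine (toReal_interpolation hq hr (h2.sub hm2) (hc.sub hmc)).trans ?_
  have hA : (eLpNorm (fun x => fn u x - moll φ (fn u) x) 2 volume).toReal ≤ φ.rOut * M :=
    (toReal_eLpNorm_sub_moll_le φ u).trans
      (mul_le_mul_of_nonneg_left hu φ.rOut_pos.le)
  have hB : (eLpNorm (fun x => fn u x - moll φ (fn u) x)
      (ENNReal.ofReal (critExp N)) volume).toReal ≤ 2 * (κ * M) := by
    have h1 := eLpNorm_sub_le hc.1 hmc.1 hr1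
    have h3 := eLpNorm_moll_le φ (Lp.stronglyMeasurable (fn u)) hr1 ENNReal.ofReal_ne_top
    have h4 := ENNReal.toReal_mono (ENNReal.add_ne_top.2 ⟨hc.2.ne, hmc.2.ne⟩) h1
    rw [ENNReal.toReal_add hc.2.ne hmc.2.ne] at h4
    have h5 := ENNReal.toReal_mono hc.2.ne h3
    have h6 := (hκ u).trans (mul_le_mul_of_nonneg_left hu hκ0.le)
    rw [normLp_eq_toReal] at h6
    exact h4.trans (by linarith)
  have h7 : 0 ≤ (critExp N - q) / (critExp N - 2) := div_nonneg (by linarith) h0.le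
  have h8 : 0 ≤ (q - 2) / (critExp N - 2) := div_nonneg (by linarith) h0.le
  have h9 : 0 ≤ critExp N := by linarith
  exact mul_le_mul
    (Real.rpow_le_rpow (by positivity) (pow_le_pow_left₀ ENNReal.toReal_nonneg hA 2) h7)
    (Real.rpow_le_rpow (by positivity) (Real.rpow_le_rpow ENNReal.toReal_nonneg hB h9) h8)
    (by positivity) (by positivity)

/-- Pointwise `|w|^q ≤ δ^(q-2) |w|²`, combined with the `L²` contractivity of mollification. -/
theorem moll_rpow_le_of_forall_le {q : ℝ} (hq : 2 < q) (φ : ContDiffBump (0 : Eucl N)) (u : H1 N)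
    {δ : ℝ} (hδ : 0 ≤ δ) (h : ∀ y, ‖moll φ (fn u) y‖ ≤ δ) :
    (eLpNorm (moll φ (fn u)) (ENNReal.ofReal q) volume).toReal ^ q
      ≤ δ ^ (q - 2) * normLp 2 u ^ 2 := by
  have hle : ∀ y, ‖moll φ (fn u) y‖ₑ ^ q
      ≤ ENNReal.ofReal (δ ^ (q - 2)) * ‖moll φ (fn u) y‖ₑ ^ (2 : ℝ) := fun y => by
    have h1 : ‖moll φ (fn u) y‖ₑ ≤ ENNReal.ofReal δ := by
      rw [← ofReal_norm]; exact ENNReal.ofReal_le_ofReal (h y)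
    rw [← ENNReal.ofReal_rpow_of_nonneg hδ (by linarith)]
    calc ‖moll φ (fn u) y‖ₑ ^ q = ‖moll φ (fn u) y‖ₑ ^ (q - 2) * ‖moll φ (fn u) y‖ₑ ^ (2 : ℝ) := by
          rw [← ENNReal.rpow_add_of_nonneg _ _ (by linarith) (by norm_num), sub_add_cancel]
      _ ≤ _ := by gcongr
  have h2 : (eLpNorm (moll φ (fn u)) (ENNReal.ofReal 2) volume).toReal ≤ normLp 2 u := by
    rw [normLp_eq_toReal]
    refine ENNReal.toReal_mono ?_ (eLpNorm_moll_le φ (Lp.stronglyMeasurable _) (by norm_num)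
      ENNReal.ofReal_ne_top)
    simpa using (Lp.memLp (fn u)).2.ne
  have hfin : ∫⁻ y, ‖moll φ (fn u) y‖ₑ ^ (2 : ℝ) ≠ ⊤ := by
    simpa using (lintegral_rpow_enorm_lt_top_of_eLpNorm_lt_top (by norm_num) (by norm_num)
      (memLp_moll φ u (by norm_num) (by norm_num) (Lp.memLp (fn u))).2).ne
  rw [toReal_eLpNorm_rpow (by linarith)]
  have h3 := lintegral_mono (μ := volume) hle
  rw [lintegral_const_mul' _ _ ENNReal.ofReal_ne_top] at h3
  have h4 := ENNReal.toReal_mono (ENNReal.mul_ne_top ENNReal.ofReal_ne_top hfin) h3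
  rw [ENNReal.toReal_mul, ENNReal.toReal_ofReal (by positivity),
    ← toReal_eLpNorm_rpow two_pos, Real.rpow_two] at h4
  exact h4.trans (by gcongr)

/-- Nonvanishing: an `H¹`-bounded function whose subcritical norm is not small has a mollification
which is not small at some point. -/
theorem exists_moll_ge (hN : 3 ≤ N) {q : ℝ} (hq : 2 < q) (hq' : q < 2 + 4 / N) {M η : ℝ}
    (hη : 0 < η) : ∃ φ : ContDiffBump (0 : Eucl N), ∃ δ : ℝ, 0 < δ ∧ ∀ u : H1 N,
      normLp 2 u ≤ M → gradNorm u ≤ M → η ≤ normLp q u → ∃ y, δ ≤ ‖moll φ (fn u) y‖ := by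
  obtain ⟨κ, hκ0, hκ⟩ := exists_normLp_critExp_le hN
  have hr := lt_critExp hN hq'
  have ht1 : 0 < (critExp N - q) / (critExp N - 2) := div_pos (by linarith) (by linarith)
  have hlim : Tendsto (fun n => (((bumpSeq N n).rOut * M) ^ 2) ^ ((critExp N - q) / (critExp N - 2))
        * ((2 * (κ * M)) ^ critExp N) ^ ((q - 2) / (critExp N - 2))) atTop (𝓝 0) := by
    have h1 : Tendsto (fun n => ((bumpSeq N n).rOut * M) ^ 2) atTop (𝓝 0) := by
      simpa using ((tendsto_rOut_bumpSeq (N := N)).mul_const M).pow 2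
    have h2 := (Real.continuousAt_rpow_const 0 _ (Or.inr ht1.le)).tendsto.comp h1
    rw [Real.zero_rpow ht1.ne'] at h2
    simpa using h2.mul_const (((2 * (κ * M)) ^ critExp N) ^ ((q - 2) / (critExp N - 2)))
  -- The bump makes the mollification error less than `η/2` in `L^q`, and `δ` is such that a
  -- mollification below `δ` everywhere has `L^q` norm less than `η/2`; together these contradict `η
  -- ≤ normLp q u`.
  obtain ⟨n, hn⟩ := (hlim.eventually_lt_const
    (by positivity : 0 < (η / 2) ^ q)).exists
  have hlim2 : Tendsto (fun δ : ℝ => δ ^ (q - 2) * M ^ 2) (𝓝[>] 0) (𝓝 0) := by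
    have h0 := ((Real.continuousAt_rpow_const 0 (q - 2) (Or.inr (by linarith))).tendsto.mul_const
      (M ^ 2)).mono_left (nhdsWithin_le_nhds (s := Ioi 0))
    rwa [Real.zero_rpow (by linarith), zero_mul] at h0
  obtain ⟨δ, hδ, hδ0⟩ := ((hlim2.eventually_lt_const
    (by positivity : 0 < (η / 2) ^ q)).and self_mem_nhdsWithin).exists
  replace hδ0 : 0 < δ := hδ0
  refine ⟨bumpSeq N n, δ, hδ0, fun u hu2 hug huq => ?_⟩
  by_contra! hcon
  have hD := (sub_moll_subcritical_le hN hq hq' (fun u => (hκ u).2) hκ0 (bumpSeq N n) hug).trans_lt hn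
  have hE : (eLpNorm (moll (bumpSeq N n) (fn u)) (ENNReal.ofReal q) volume).toReal ^ q
      < (η / 2) ^ q := by
    refine (moll_rpow_le_of_forall_le hq _ u hδ0.le fun y => (hcon y).le).trans_lt
      (lt_of_le_of_lt ?_ hδ)
    have := normLp_nonneg 2 u
    gcongr
  rw [Real.rpow_lt_rpow_iff ENNReal.toReal_nonneg (by positivity) (by linarith)] at hD hE
  have hq1 : 1 ≤ ENNReal.ofReal q := by simp; linarith
  have hmq := memLp_subcritical hN hq hq' u
  have hmm := memLp_moll (bumpSeq N n) u hq1 ENNReal.ofReal_ne_top hmq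
  have hadd := eLpNorm_add_le (μ := volume) (hmq.sub hmm).1 hmm.1 hq1
  have e : (⇑(fn u) - moll (bumpSeq N n) ⇑(fn u)) + moll (bumpSeq N n) ⇑(fn u) = fn u := by
    funext x; simp
  rw [e] at hadd
  have h4 := ENNReal.toReal_mono (ENNReal.add_ne_top.2 ⟨(hmq.sub hmm).2.ne, hmm.2.ne⟩) hadd
  rw [ENNReal.toReal_add (hmq.sub hmm).2.ne hmm.2.ne, ← normLp_eq_toReal] at h4
  have h5 : (eLpNorm (⇑(fn u) - moll (bumpSeq N n) ⇑(fn u)) (ENNReal.ofReal q) volume).toReal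
      < η / 2 := hD
  linarith

/-! ### Weak limits and local compactness in H¹. -/

/-- Bounded sequences in a separable Hilbert space have weakly convergent subsequences. -/
theorem exists_weak_subseq {H : Type*} [NormedAddCommGroup H] [InnerProductSpace ℂ H]
    [CompleteSpace H] [TopologicalSpace.SeparableSpace H] {u : ℕ → H} {M : ℝ}
    (hu : ∀ n, ‖u n‖ ≤ M) : ∃ k : ℕ → ℕ, StrictMono k ∧ ∃ v : H, ∀ h : H,
      Tendsto (fun n => inner ℂ h (u (k n))) atTop (𝓝 (inner ℂ h v)) := by
  -- Sequential Banach–Alaoglu for the functionals `⟨u n, ·⟩`; conjugation later moves `u n` to the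
  -- second slot.
  obtain ⟨f, -, k, hk, hf⟩ := WeakDual.isSeqCompact_closedBall ℂ H 0 M
    (x := fun n => StrongDual.toWeakDual (InnerProductSpace.toDual ℂ H (u n))) (fun n => by
      change InnerProductSpace.toDual ℂ H (u n) ∈ Metric.closedBall 0 M
      rw [mem_closedBall_zero_iff, LinearIsometryEquiv.norm_map]
      exact hu n)
  refine ⟨k, hk, (InnerProductSpace.toDual ℂ H).symm (WeakDual.toStrongDual f), fun h => ?_⟩
  have h1 := (WeakDual.eval_continuous h).tendsto f |>.comp hf
  have h2 : Tendsto (fun n => inner ℂ (u (k n)) h) atTop (𝓝 (f h)) := h1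
  have h3 : f h = inner ℂ ((InnerProductSpace.toDual ℂ H).symm (WeakDual.toStrongDual f)) h := by
    rw [InnerProductSpace.toDual_symm_apply]; rfl
  rw [h3] at h2
  have h4 := (Complex.continuous_conj.tendsto _).comp h2
  rw [inner_conj_symm] at h4
  refine h4.congr fun n => ?_
  simp [inner_conj_symm]

theorem inner_coord (ψ : Eucl N → ℝ) (hψ : Continuous ψ) (hc : HasCompactSupport ψ) (i : Fin N) :
    ∃ k : L2Vec N, ∀ g : L2Vec N, inner ℂ k g = ∫ x, ψ x • (g x) i := by
  set P := (EuclideanSpace.proj i : EuclideanSpace ℂ (Fin N) →L[ℂ] ℂ).compLpL 2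
    (volume : Measure (Eucl N))
  refine ⟨ContinuousLinearMap.adjoint P (testL2 ψ hψ hc), fun g => ?_⟩
  rw [ContinuousLinearMap.adjoint_inner_left, inner_testL2]
  refine integral_congr_ae ?_
  filter_upwards [(EuclideanSpace.proj i : EuclideanSpace ℂ (Fin N) →L[ℂ] ℂ).coeFn_compLpL g]
    with x hx
  rw [hx]
  rfl

/-- Both sides of the weak gradient identity are pairings with fixed `L²` elements, so they pass to
weak limits. -/
theorem isWeakGradient_of_weak_limit {u : ℕ → H1 N} {f : L2 N} {g : L2Vec N}
    (hf : ∀ h : L2 N, Tendsto (fun n => inner ℂ h (fn (u n))) atTop (𝓝 (inner ℂ h f)))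
    (hg : ∀ h : L2Vec N, Tendsto (fun n => inner ℂ h (grad (u n))) atTop (𝓝 (inner ℂ h g))) :
    IsWeakGradient f g := by
  intro φ hφ hc i
  have hd : Continuous fun x => fderiv ℝ φ x (EuclideanSpace.single i 1) :=
    (hφ.continuous_fderiv (by simp)).clm_apply continuous_const
  have h1 := hf (testL2 _ hd (hc.fderiv_apply (𝕜 := ℝ) (EuclideanSpace.single i 1)))
  obtain ⟨k, hk⟩ := inner_coord φ hφ.continuous hc i
  have h2 := hg k
  simp only [inner_testL2, hk] at h1 h2
  exact tendsto_nhds_unique h1 (h2.neg.congr fun n => ((u n).2 φ hφ hc i).symm)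

/-- Bounded sequences in `H¹` have weakly convergent subsequences. -/
theorem exists_weak_subseq_H1 {u : ℕ → H1 N} {M : ℝ} (h2 : ∀ n, normLp 2 (u n) ≤ M)
    (hg : ∀ n, gradNorm (u n) ≤ M) : ∃ k : ℕ → ℕ, StrictMono k ∧ ∃ v : H1 N,
      (∀ h : L2 N, Tendsto (fun n => inner ℂ h (fn (u (k n)))) atTop (𝓝 (inner ℂ h (fn v)))) ∧
      ∀ h : L2Vec N, Tendsto (fun n => inner ℂ h (grad (u (k n)))) atTop
        (𝓝 (inner ℂ h (grad v))) := by
  have : Fact ((2 : ℝ≥0∞) ≠ ⊤) := ⟨by norm_num⟩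
  obtain ⟨k₁, hk₁, f, hf⟩ := exists_weak_subseq (u := fun n => fn (u n)) (M := M)
    fun n => by rw [← normLp_two]; exact h2 n
  obtain ⟨k₂, hk₂, g, hg'⟩ := exists_weak_subseq (u := fun n => grad (u (k₁ n))) (M := M)
    fun n => hg _
  have hf' : ∀ h : L2 N, Tendsto (fun n => inner ℂ h (fn (u (k₁ (k₂ n))))) atTop
      (𝓝 (inner ℂ h f)) := fun h => (hf h).comp hk₂.tendsto_atTop
  exact ⟨k₁ ∘ k₂, hk₁.comp hk₂, ⟨WithLp.toLp 2 (f, g), isWeakGradient_of_weak_limit hf' hg'⟩,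
    hf', hg'⟩

theorem tendsto_moll_of_weak {u : ℕ → L2 N} {v : L2 N}
    (h : ∀ h : L2 N, Tendsto (fun n => inner ℂ h (u n)) atTop (𝓝 (inner ℂ h v)))
    (φ : ContDiffBump (0 : Eucl N)) (x : Eucl N) :
    Tendsto (fun n => moll φ (u n) x) atTop (𝓝 (moll φ v x)) := by
  obtain ⟨k, -, hk⟩ := moll_eq_inner φ x
  simpa only [hk] using h k

/-- A finite measure with a positive density bounded by one. -/
noncomputable def weight (N : ℕ) : Measure (Eucl N) :=
  volume.withDensity fun x => ENNReal.ofReal ((1 + ‖x‖) ^ (-(N + 1 : ℝ)))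

theorem measurable_weight_density :
    Measurable fun x : Eucl N => ENNReal.ofReal ((1 + ‖x‖) ^ (-(N + 1 : ℝ))) := by fun_prop

instance : IsFiniteMeasure (weight N) :=
  isFiniteMeasure_withDensity_ofReal
    (integrable_one_add_norm (by rw [finrank_euclideanSpace_fin]; linarith)).2

theorem weight_le_volume : weight N ≤ volume := by
  have h : (fun x : Eucl N => ENNReal.ofReal ((1 + ‖x‖) ^ (-(N + 1 : ℝ)))) ≤ 1 := fun x => by
    refine ENNReal.ofReal_le_one.2 (Real.rpow_le_one_of_one_le_of_nonpos ?_ ?_)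
    · linarith [norm_nonneg x]
    · have : (0 : ℝ) ≤ N := N.cast_nonneg
      linarith
  calc weight N ≤ volume.withDensity 1 := withDensity_mono (Eventually.of_forall h)
    _ = volume := withDensity_one

/-- Positivity of the density transfers almost everywhere convergence from the weighted measure back
to Lebesgue measure. -/
theorem volume_absolutelyContinuous_weight : (volume : Measure (Eucl N)) ≪ weight N := by
  refine withDensity_absolutelyContinuous' measurable_weight_density.aemeasurable
    (Eventually.of_forall fun x => ?_)
  have : (0 : ℝ) < (1 + ‖x‖) ^ (-(N + 1 : ℝ)) := Real.rpow_pos_of_pos (by positivity) _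
  simpa using this

theorem tendsto_eLpNorm_two_of_bounded {X : Type*} [MeasurableSpace X] {ν : Measure X}
    [IsFiniteMeasure ν] {f : ℕ → X → ℂ} (hm : ∀ n, Measurable (f n)) {B : ℝ}
    (hB : ∀ n x, ‖f n x‖ ≤ B) (h : ∀ x, Tendsto (fun n => f n x) atTop (𝓝 0)) :
    Tendsto (fun n => eLpNorm (f n) 2 ν) atTop (𝓝 0) := by
  have h1 : Tendsto (fun n => ∫⁻ x, ‖f n x‖ₑ ^ (2 : ℝ) ∂ν) atTop (𝓝 (∫⁻ _, 0 ∂ν)) := by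
    refine tendsto_lintegral_of_dominated_convergence (fun _ => ENNReal.ofReal B ^ (2 : ℝ))
      (fun n => (hm n).enorm.pow_const _) (fun n => Eventually.of_forall fun x => ?_) ?_
      (Eventually.of_forall fun x => ?_)
    · dsimp only
      gcongr
      rw [← ofReal_norm]
      exact ENNReal.ofReal_le_ofReal (hB n x)
    · rw [lintegral_const]
      exact ENNReal.mul_ne_top (ENNReal.rpow_ne_top_of_nonneg (by norm_num) ENNReal.ofReal_ne_top)
        (measure_ne_top _ _)
    · have h2 := (ENNReal.continuous_rpow_const (y := 2)).tendsto _ |>.comp (h x).enorm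
      simpa [Function.comp_def] using h2
  have h3 := (ENNReal.continuous_rpow_const (y := 1 / 2)).tendsto _ |>.comp h1
  simp only [lintegral_zero] at h3
  rw [ENNReal.zero_rpow_of_pos (by norm_num)] at h3
  refine h3.congr fun n => ?_
  rw [eLpNorm_eq_lintegral_rpow_enorm_toReal (by norm_num) (by norm_num)]
  simp

/-- Local compactness: a bounded sequence in `H¹` converging weakly to zero in `L²` has an almost
everywhere convergent subsequence. -/
theorem exists_subseq_ae_tendsto {w : ℕ → H1 N} {M : ℝ} (h2 : ∀ n, normLp 2 (w n) ≤ M)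
    (hg : ∀ n, gradNorm (w n) ≤ M)
    (hw : ∀ (φ : ContDiffBump (0 : Eucl N)) x, Tendsto (fun n => moll φ (fn (w n)) x) atTop (𝓝 0)) :
    ∃ k : ℕ → ℕ, StrictMono k ∧ ∀ᵐ x, Tendsto (fun n => fn (w (k n)) x) atTop (𝓝 0) := by
  have hM : 0 ≤ M := (gradNorm_nonneg _).trans (hg 0)
  -- Strong convergence can fail in `L²` of Lebesgue measure but holds for the finite weight:
  -- mollifications are uniformly bounded and converge pointwise, and the mollification error is
  -- uniformly small since the weight is below volume.
  have hmain : Tendsto (fun n => eLpNorm (fn (w n)) 2 (weight N)) atTop (𝓝 0) := by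
    rw [ENNReal.tendsto_nhds_zero]
    intro ε hε
    have hlim : Tendsto (fun j => ENNReal.ofReal ((bumpSeq N j).rOut * M)) atTop (𝓝 0) := by
      have := ENNReal.tendsto_ofReal ((tendsto_rOut_bumpSeq (N := N)).mul_const M)
      simpa only [zero_mul, ENNReal.ofReal_zero] using this
    have hε2 : 0 < ε / 2 := ENNReal.half_pos hε.ne'
    obtain ⟨j, hj⟩ := ((ENNReal.tendsto_nhds_zero.1 hlim) (ε / 2) hε2).exists
    have hmo := tendsto_eLpNorm_two_of_bounded (ν := weight N)
      (f := fun n => moll (bumpSeq N j) (fn (w n)))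
      (fun n => (continuous_moll _ (w n)).measurable)
      (B := (eLpNorm ((bumpSeq N j).normed volume) 2 volume).toReal * M)
      (fun n x => (norm_moll_le _ _ x).trans (by
        rw [← normLp_two]
        exact mul_le_mul_of_nonneg_left (h2 n) ENNReal.toReal_nonneg)) (hw (bumpSeq N j))
    filter_upwards [(ENNReal.tendsto_nhds_zero.1 hmo) (ε / 2) hε2] with n hn
    have hd : MemLp (fun x => fn (w n) x - moll (bumpSeq N j) (fn (w n)) x) 2 volume :=
      (Lp.memLp (fn (w n))).sub (memLp_moll _ (w n) (by norm_num) (by norm_num) (Lp.memLp _))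
    have h3 : eLpNorm (fun x => fn (w n) x - moll (bumpSeq N j) (fn (w n)) x) 2 (weight N)
        ≤ ε / 2 := by
      refine (eLpNorm_mono_measure _ weight_le_volume).trans (le_trans ?_ hj)
      rw [← ENNReal.ofReal_toReal hd.2.ne]
      exact ENNReal.ofReal_le_ofReal ((toReal_eLpNorm_sub_moll_le _ (w n)).trans
        (mul_le_mul_of_nonneg_left (hg n) (bumpSeq N j).rOut_pos.le))
    have hadd := eLpNorm_add_le (p := 2) (hd.1.mono_measure weight_le_volume)
      (continuous_moll (bumpSeq N j) (w n)).aestronglyMeasurable (by norm_num)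
    have e : (fun x => fn (w n) x - moll (bumpSeq N j) (fn (w n)) x)
        + moll (bumpSeq N j) (fn (w n)) = fn (w n) := by funext x; simp
    rw [e] at hadd
    exact hadd.trans ((add_le_add h3 hn).trans (ENNReal.add_halves ε).le)
  have htm : TendstoInMeasure (weight N) (fun n => ⇑(fn (w n))) atTop 0 :=
    tendstoInMeasure_of_tendsto_eLpNorm (p := 2) (by norm_num)
      (fun n => (Lp.stronglyMeasurable _).aestronglyMeasurable) aestronglyMeasurable_zero
      (by simpa only [sub_zero] using hmain)
  obtain ⟨k, hk, hae⟩ := htm.exists_seq_tendsto_ae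
  exact ⟨k, hk, volume_absolutelyContinuous_weight.ae_le hae⟩

/-! ### The Brezis–Lieb lemma and its Hilbert space analogue. -/

/-- Convexity applied to `x + y = t (x/t) + (1-t) (y/(1-t))`, with `t < 1` so close to one that
`t^(1-p) < 1 + ε`. -/
theorem exists_add_rpow_le {p : ℝ} (hp : 1 < p) {ε : ℝ} (hε : 0 < ε) : ∃ C : ℝ, 0 ≤ C ∧
    ∀ x y : ℝ, 0 ≤ x → 0 ≤ y → (x + y) ^ p ≤ (1 + ε) * x ^ p + C * y ^ p := by
  have hlim : Tendsto (fun t : ℝ => t ^ (1 - p)) (𝓝[<] 1) (𝓝 1) := by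
    have h := (Real.continuousAt_rpow_const 1 (1 - p) (Or.inl one_ne_zero)).tendsto.mono_left
      (nhdsWithin_le_nhds (s := Iio 1))
    rwa [Real.one_rpow] at h
  obtain ⟨t, ⟨ht, ht0⟩, ht1⟩ := (((hlim.eventually_lt_const (by linarith : 1 < 1 + ε)).and
    (nhdsWithin_le_nhds (eventually_gt_nhds (zero_lt_one' ℝ)))).and self_mem_nhdsWithin).exists
  replace ht1 : t < 1 := ht1
  have hs : 0 < 1 - t := by linarith
  refine ⟨(1 - t) ^ (1 - p), by positivity, fun x y hx hy => ?_⟩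
  have hconv := (convexOn_rpow hp.le).2 (mem_Ici.2 (by positivity : 0 ≤ x / t))
    (mem_Ici.2 (by positivity : 0 ≤ y / (1 - t))) ht0.le hs.le (by ring)
  simp only [smul_eq_mul] at hconv
  rw [mul_div_cancel₀ _ ht0.ne', mul_div_cancel₀ _ hs.ne', Real.div_rpow hx ht0.le,
    Real.div_rpow hy hs.le] at hconv
  have e : ∀ {s : ℝ}, 0 < s → ∀ z : ℝ, s * (z / s ^ p) = s ^ (1 - p) * z := fun {s} h z => by
    rw [Real.rpow_sub h, Real.rpow_one]; ring
  rw [e ht0, e hs] at hconv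
  refine hconv.trans ?_
  have := Real.rpow_nonneg hx p
  gcongr

theorem exists_abs_rpow_sub_le {E : Type*} [NormedAddCommGroup E] {p : ℝ} (hp : 1 < p) {ε : ℝ}
    (hε : 0 < ε) : ∃ C : ℝ, 0 ≤ C ∧
    ∀ a b : E, |‖a + b‖ ^ p - ‖a‖ ^ p| ≤ ε * ‖a‖ ^ p + C * ‖b‖ ^ p := by
  obtain ⟨C, hC, h⟩ := exists_add_rpow_le hp (lt_min (half_pos hε) one_pos)
  -- The lower bound applies the estimate twice, to `a = (a + b) - b` and then to `a + b`; this
  -- choice gives `η(1+η) ≤ ε` and `(1+η)C ≤ 2C`.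
  set η := min (ε / 2) 1
  have hη0 : 0 < η := lt_min (half_pos hε) one_pos
  have hη1 : η ≤ 1 := min_le_right _ _
  have hη2 : η ≤ ε / 2 := min_le_left _ _
  refine ⟨2 * C, by positivity, fun a b => ?_⟩
  have hp0 : 0 ≤ p := by linarith
  have ha : 0 ≤ ‖a‖ ^ p := by positivity
  have hb : 0 ≤ C * ‖b‖ ^ p := by positivity
  have h1 : ‖a + b‖ ^ p ≤ (1 + η) * ‖a‖ ^ p + C * ‖b‖ ^ p :=
    (Real.rpow_le_rpow (norm_nonneg _) (norm_add_le a b) hp0).trans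
      (h _ _ (norm_nonneg _) (norm_nonneg _))
  have h2 : ‖a‖ ^ p ≤ (1 + η) * ‖a + b‖ ^ p + C * ‖b‖ ^ p := by
    refine (Real.rpow_le_rpow (norm_nonneg _) ?_ hp0).trans
      (h _ _ (norm_nonneg _) (norm_nonneg _))
    calc ‖a‖ = ‖(a + b) - b‖ := by simp
      _ ≤ _ := norm_sub_le _ _
  rw [abs_le]
  constructor
  · have h3 := mul_le_mul_of_nonneg_left h1 hη0.le
    have h4 : η * (1 + η) ≤ ε := by nlinarith
    have h5 := mul_le_mul_of_nonneg_right h4 ha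
    have h6 := mul_le_mul_of_nonneg_right hη1 hb
    linarith
  · nlinarith

/-- The Brezis-Lieb lemma. -/
theorem brezis_lieb {X E : Type*} [MeasurableSpace X] [NormedAddCommGroup E] {ν : Measure X}
    {p : ℝ} (hp : 1 < p) {w : ℕ → X → E} {f : X → E}
    (hw : ∀ n, MemLp (w n) (ENNReal.ofReal p) ν) (hf : MemLp f (ENNReal.ofReal p) ν) {M : ℝ}
    (hM : ∀ n, ∫ x, ‖w n x‖ ^ p ∂ν ≤ M) (h : ∀ᵐ x ∂ν, Tendsto (fun n => w n x) atTop (𝓝 0)) :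
    Tendsto (fun n => ∫ x, ‖w n x + f x‖ ^ p ∂ν - ∫ x, ‖w n x‖ ^ p ∂ν) atTop
      (𝓝 (∫ x, ‖f x‖ ^ p ∂ν)) := by
  have hp0 : 0 < p := by linarith
  have hpe : ENNReal.ofReal p ≠ 0 := by simpa using hp0
  have hpow : ∀ {g : X → E}, MemLp g (ENNReal.ofReal p) ν → Integrable (fun x => ‖g x‖ ^ p) ν :=
    fun hg => by
      have := hg.integrable_norm_rpow hpe ENNReal.ofReal_ne_top
      rwa [ENNReal.toReal_ofReal hp0.le] at this
  have hiw := fun n => hpow (hw n)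
  have hif := hpow hf
  have hiwf : ∀ n, Integrable (fun x => ‖w n x + f x‖ ^ p) ν := fun n => hpow ((hw n).add hf)
  set D : ℕ → X → ℝ := fun n x => |‖w n x + f x‖ ^ p - ‖w n x‖ ^ p - ‖f x‖ ^ p|
  have hD : ∀ n, Integrable (D n) ν := fun n => (((hiwf n).sub (hiw n)).sub hif).abs
  have hpc : Tendsto (fun t : ℝ => t ^ p) (𝓝 0) (𝓝 0) := by
    have := (Real.continuousAt_rpow_const 0 p (Or.inr hp0.le)).tendsto
    rwa [Real.zero_rpow hp0.ne'] at this
  have hDlim : ∀ᵐ x ∂ν, Tendsto (fun n => D n x) atTop (𝓝 0) := by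
    filter_upwards [h] with x hx
    have h1 : Tendsto (fun n => ‖w n x‖ ^ p) atTop (𝓝 0) :=
      hpc.comp (by simpa using hx.norm)
    have h2 : Tendsto (fun n => ‖w n x + f x‖ ^ p) atTop (𝓝 (‖f x‖ ^ p)) := by
      have h3 : Tendsto (fun n => ‖w n x + f x‖) atTop (𝓝 ‖f x‖) := by
        simpa using (hx.add_const (f x)).norm
      exact (Real.continuousAt_rpow_const _ p (Or.inr hp0.le)).tendsto.comp h3
    simpa using ((h2.sub h1).sub_const (‖f x‖ ^ p)).abs
  have hM0 : 0 ≤ M := (integral_nonneg fun x => by positivity).trans (hM 0)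
  have hDint : Tendsto (fun n => ∫ x, D n x ∂ν) atTop (𝓝 0) := by
    rw [Metric.tendsto_atTop]
    intro ε hε
    obtain ⟨C, hC, hpt⟩ := exists_abs_rpow_sub_le (E := E) hp
      (by positivity : 0 < ε / (2 * (M + 1)))
    set η := ε / (2 * (M + 1)) with hη
    have hη0 : 0 < η := by positivity
    -- The excess of `D n` over `η ‖w n‖^p` is dominated by a fixed multiple of `‖f‖^p`, so
    -- dominated convergence applies to it; what is left costs at most `η (M + 1) = ε/2`.
    have hGi : ∀ n, Integrable (fun x => max (D n x - η * ‖w n x‖ ^ p) 0) ν := fun n =>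
      ((hD n).sub ((hiw n).const_mul η)).sup (integrable_zero _ _ _)
    have hG : Tendsto (fun n => ∫ x, max (D n x - η * ‖w n x‖ ^ p) 0 ∂ν) atTop (𝓝 (∫ _, 0 ∂ν)) := by
      refine tendsto_integral_of_dominated_convergence (fun x => (1 + C) * ‖f x‖ ^ p)
        (fun n => (hGi n).1) (hif.const_mul _) (fun n => Eventually.of_forall fun x => ?_) ?_
      · rw [Real.norm_of_nonneg (le_max_right _ _)]
        have hfx : 0 ≤ ‖f x‖ ^ p := by positivity
        refine max_le ?_ (by positivity)
        have h1 := hpt (w n x) (f x)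
        have h2 : D n x ≤ |‖w n x + f x‖ ^ p - ‖w n x‖ ^ p| + |‖f x‖ ^ p| := abs_sub _ _
        rw [abs_of_nonneg hfx] at h2
        linarith
      · filter_upwards [hDlim] with x hx
        refine squeeze_zero (fun n => le_max_right _ _) (fun n => ?_) hx
        have hwx : 0 ≤ ‖w n x‖ ^ p := by positivity
        exact max_le (by nlinarith) (abs_nonneg _)
    rw [integral_zero] at hG
    obtain ⟨n₀, hn₀⟩ := eventually_atTop.1 (hG.eventually_lt_const (half_pos hε))
    refine ⟨n₀, fun n hn => ?_⟩
    rw [Real.dist_eq, sub_zero, abs_of_nonneg (integral_nonneg fun x => abs_nonneg _)]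
    have hle : ∫ x, D n x ∂ν
        ≤ ∫ x, (max (D n x - η * ‖w n x‖ ^ p) 0 + η * ‖w n x‖ ^ p) ∂ν := by
      refine integral_mono (hD n) ((hGi n).add ((hiw n).const_mul η)) fun x => ?_
      have := le_max_left (D n x - η * ‖w n x‖ ^ p) 0
      dsimp only
      linarith
    rw [integral_add (hGi n) ((hiw n).const_mul η), integral_const_mul] at hle
    have h3 : η * ∫ x, ‖w n x‖ ^ p ∂ν ≤ ε / 2 := by
      calc η * ∫ x, ‖w n x‖ ^ p ∂ν ≤ η * (M + 1) := by gcongr; linarith [hM n]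
        _ = ε / 2 := by rw [hη]; field_simp
    linarith [hn₀ n hn]
  rw [tendsto_iff_norm_sub_tendsto_zero]
  refine squeeze_zero (fun n => norm_nonneg _) (fun n => ?_) hDint
  have hsub : Integrable (fun x => ‖w n x + f x‖ ^ p - ‖w n x‖ ^ p) ν := (hiwf n).sub (hiw n)
  rw [← integral_sub (hiwf n) (hiw n), ← integral_sub hsub hif]
  exact norm_integral_le_integral_norm _

theorem normLp_rpow_eq_integral {p : ℝ} (hp : 0 < p) (u : H1 N) :
    normLp p u ^ p = ∫ x, ‖fn u x‖ ^ p := by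
  rw [normLp_rpow hp, integral_eq_lintegral_of_nonneg_ae
    (Eventually.of_forall fun x => by positivity)
    ((Lp.stronglyMeasurable (fn u)).norm.measurable.pow_const p).aestronglyMeasurable]
  congr 1
  refine lintegral_congr fun x => ?_
  rw [← ENNReal.ofReal_rpow_of_nonneg (norm_nonneg _) hp.le, ofReal_norm]

/-- Splitting of Lebesgue norms along an almost everywhere convergent sequence in `H¹`. -/
theorem tendsto_normLp_rpow_sub {p : ℝ} (hp : 1 < p)
    (hmem : ∀ u : H1 N, MemLp (fn u) (ENNReal.ofReal p) volume) {u : ℕ → H1 N} {v : H1 N} {M : ℝ}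
    (hM : ∀ n, normLp p (u n - v) ^ p ≤ M)
    (h : ∀ᵐ x, Tendsto (fun n => fn (u n - v) x) atTop (𝓝 0)) :
    Tendsto (fun n => normLp p (u n) ^ p - normLp p (u n - v) ^ p) atTop
      (𝓝 (normLp p v ^ p)) := by
  have hp0 : 0 < p := by linarith
  have hbl := brezis_lieb hp (fun n => hmem (u n - v)) (hmem v)
    (fun n => by rw [← normLp_rpow_eq_integral hp0]; exact hM n) h
  rw [← normLp_rpow_eq_integral hp0] at hbl
  refine hbl.congr fun n => ?_
  rw [← normLp_rpow_eq_integral hp0, normLp_rpow_eq_integral hp0 (u n)]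
  congr 1
  refine integral_congr_ae ?_
  have e : fn (u n) = fn (u n - v) + fn v := by rw [← fn_add, sub_add_cancel]
  filter_upwards [Lp.coeFn_add (fn (u n - v)) (fn v)] with x hx
  rw [e, hx, Pi.add_apply]

/-- Expanding the square suffices in a Hilbert space. This handles gradients, for which no almost
everywhere convergence is available. -/
theorem tendsto_norm_sq_sub_of_weak {H : Type*} [NormedAddCommGroup H] [InnerProductSpace ℂ H]
    {u : ℕ → H} {v : H}
    (h : ∀ k : H, Tendsto (fun n => inner ℂ k (u n)) atTop (𝓝 (inner ℂ k v))) :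
    Tendsto (fun n => ‖u n‖ ^ 2 - ‖u n - v‖ ^ 2) atTop (𝓝 (‖v‖ ^ 2)) := by
  have h1 := (Complex.continuous_re.tendsto _).comp (h v)
  have h2 : (inner ℂ v v).re = ‖v‖ ^ 2 := by
    have := inner_self_eq_norm_sq (𝕜 := ℂ) v
    simpa using this
  rw [h2] at h1
  have h3 := (h1.const_mul 2).sub_const (‖v‖ ^ 2)
  have e : 2 * ‖v‖ ^ 2 - ‖v‖ ^ 2 = ‖v‖ ^ 2 := by ring
  rw [e] at h3
  refine h3.congr fun n => ?_
  have h4 := norm_sub_sq (𝕜 := ℂ) (u n) v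
  have h5 : RCLike.re (inner ℂ (u n) v) = (inner ℂ v (u n)).re :=
    inner_re_symm (𝕜 := ℂ) _ _
  rw [h4, h5]
  simp only [Function.comp]
  ring

/-! ### Compactness of minimizing sequences. -/

section Minimizers

variable {q μ C : ℝ}

/-- The gradient exponent in Gagliardo–Nirenberg is positive, so a zero gradient would force `normLp
q u = 0`. Applied to the weak limit, it gives the slack that keeps the remainders in the gradient
ball. -/
theorem gradNorm_pos_of_mass_pos (hN : 3 ≤ N) (hq : 2 < q) (hq' : q < 2 + 4 / N)
    (hC : gnConst N q ≤ C) {u : H1 N} (hu : 0 < normLp 2 u) : 0 < gradNorm u := by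
  refine (gradNorm_nonneg u).lt_of_ne fun h => ?_
  have h1 := (gagliardo_nirenberg hN hq hq' hC).2 u
  have h3 : (3 : ℝ) ≤ N := by exact_mod_cast hN
  have hβ : (N * (1 / 2 - 1 / q) : ℝ) ≠ 0 := by
    have : 1 / q < 1 / 2 := one_div_lt_one_div_of_lt two_pos hq
    exact (mul_pos (by linarith) (by linarith)).ne'
  rw [← h, Real.zero_rpow hβ, mul_zero, zero_mul] at h1
  exact h1.not_gt (normLp_pos_of_mass_pos hN hq hq' hu)

/-- Sequences of uniformly negative energy in `B_{ρ₀}` have translates with a nonzero weak limit,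
along which they also converge almost everywhere. -/
theorem exists_translates_weak_limit (hN : 3 ≤ N) (hq : 2 < q) (hq' : q < 2 + 4 / N)
    {M η : ℝ} (hη : 0 < η) {u : ℕ → H1 N} (h2 : ∀ n, normLp 2 (u n) ≤ M)
    (hg : ∀ n, gradNorm (u n) ≤ M) (hu : ∀ n, η ≤ normLp q (u n)) :
    ∃ k : ℕ → ℕ, StrictMono k ∧ ∃ y : ℕ → Eucl N, ∃ v : H1 N, 0 < normLp 2 v ∧
      (∀ h : L2 N, Tendsto (fun n => inner ℂ h (fn (shift (y n) (u (k n))))) atTop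
        (𝓝 (inner ℂ h (fn v)))) ∧
      (∀ h : L2Vec N, Tendsto (fun n => inner ℂ h (grad (shift (y n) (u (k n))))) atTop
        (𝓝 (inner ℂ h (grad v)))) ∧
      ∀ᵐ x, Tendsto (fun n => fn (shift (y n) (u (k n)) - v) x) atTop (𝓝 0) := by
  obtain ⟨φ, δ, hδ, hφ⟩ := exists_moll_ge hN hq hq' (M := M) hη
  -- The mollification is large at `y n`, so translating by `-y n` makes it large at the origin,
  -- which survives in the weak limit.
  choose y hy using fun n => hφ (u n) (h2 n) (hg n) (hu n)
  have h2' : ∀ n, normLp 2 (shift (-y n) (u n)) ≤ M := fun n => by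
    rw [normLp_shift]; exact h2 n
  have hg' : ∀ n, gradNorm (shift (-y n) (u n)) ≤ M := fun n => by
    rw [gradNorm_shift]; exact hg n
  obtain ⟨k₁, hk₁, v, hv2, hvg⟩ := exists_weak_subseq_H1 h2' hg'
  have hv : 0 < normLp 2 v := by
    have h1 := (tendsto_moll_of_weak hv2 φ 0).norm
    have h3 : δ ≤ ‖moll φ (fn v) 0‖ := by
      refine ge_of_tendsto' h1 fun n => ?_
      rw [moll_shift, zero_sub, neg_neg]
      exact hy _
    refine (normLp_nonneg 2 v).lt_of_ne fun h0 => ?_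
    have h4 := h3.trans (norm_moll_le φ (fn v) 0)
    rw [← normLp_two, ← h0, mul_zero] at h4
    linarith
  have hw2 : ∀ n, normLp 2 (shift (-y (k₁ n)) (u (k₁ n)) - v) ≤ M + normLp 2 v + gradNorm v := by
    intro n
    have h1 := h2' (k₁ n)
    have h3 := gradNorm_nonneg v
    rw [normLp_two] at h1 ⊢
    rw [normLp_two]
    exact (norm_sub_le (fn (shift (-y (k₁ n)) (u (k₁ n)))) (fn v)).trans (by linarith)
  have hwg : ∀ n, gradNorm (shift (-y (k₁ n)) (u (k₁ n)) - v) ≤ M + normLp 2 v + gradNorm v := by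
    intro n
    exact (norm_sub_le (grad (shift (-y (k₁ n)) (u (k₁ n)))) (grad v)).trans
      (by linarith [hg' (k₁ n), show gradNorm (shift (-y (k₁ n)) (u (k₁ n)))
        = ‖grad (shift (-y (k₁ n)) (u (k₁ n)))‖ from rfl, show gradNorm v = ‖grad v‖ from rfl])
  obtain ⟨k₂, hk₂, hae⟩ := exists_subseq_ae_tendsto hw2 hwg fun ψ x => by
    have hw : ∀ h : L2 N, Tendsto (fun n => inner ℂ h (fn (shift (-y (k₁ n)) (u (k₁ n)) - v)))
        atTop (𝓝 (inner ℂ h (0 : L2 N))) := fun h => by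
      simp only [fn_sub, inner_sub_right, inner_zero_right]
      simpa using (hv2 h).sub_const (inner ℂ h (fn v))
    have h1 := tendsto_moll_of_weak hw ψ x
    have h3 : moll ψ ((0 : L2 N) : Eucl N → ℂ) x = 0 := by
      obtain ⟨k, -, hk⟩ := moll_eq_inner ψ x
      rw [hk, inner_zero_right]
    rwa [h3] at h1
  exact ⟨k₁ ∘ k₂, hk₁.comp hk₂, fun n => -y (k₁ (k₂ n)), v, hv,
    fun h => (hv2 h).comp hk₂.tendsto_atTop, fun h => (hvg h).comp hk₂.tendsto_atTop, hae⟩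

/-- The coercive part of the energy is nonnegative on `B_{ρ₀}`, so energy below `m/2 < 0` must come
from the subcritical term, which is then at least `-m/2`. -/
theorem energy_eventually_nonvanishing (hN : 3 ≤ N) (hq : 2 < q) (hq' : q < 2 + 4 / N)
    (hμ : 0 < μ) (hC : 0 < C) {m : ℝ} (hm : m < 0) {u : ℕ → H1 N}
    (hu : ∀ n, gradNorm (u n) ^ 2 < rho0 N q μ C)
    (he : Tendsto (fun n => energy q μ (u n)) atTop (𝓝 m)) :
    ∃ η : ℝ, 0 < η ∧ ∀ᶠ n in atTop, η ≤ normLp q (u n) := by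
  refine ⟨(q / μ * (-(m / 2))) ^ (1 / q), ?_, ?_⟩
  · have : 0 < -(m / 2) := by linarith
    positivity
  filter_upwards [he.eventually_lt_const (by linarith : m < m / 2)] with n hn
  have h1 := energy_ge (q := q) (μ := μ) hN (hu n).le
  have h2 : 0 ≤ (1 / 2 - coefB N * rho0 N q μ C ^ (alpha2 N / 2)) * gradNorm (u n) ^ 2 :=
    mul_nonneg (by linarith [coefB_mul_rho0_lt hN hq hq' hμ hC]) (sq_nonneg _)
  have h3 : -(m / 2) ≤ μ / q * normLp q (u n) ^ q := by linarith
  have hq0 : 0 < q := by linarith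
  have h4 : q / μ * (-(m / 2)) ≤ normLp q (u n) ^ q := by
    calc q / μ * (-(m / 2)) ≤ q / μ * (μ / q * normLp q (u n) ^ q) := by gcongr
      _ = normLp q (u n) ^ q := by field_simp
  have h5 : 0 < -(m / 2) := by linarith
  calc (q / μ * (-(m / 2))) ^ (1 / q) ≤ (normLp q (u n) ^ q) ^ (1 / q) := by gcongr
    _ = normLp q (u n) := by
        rw [one_div, Real.rpow_rpow_inv (normLp_nonneg _ _) hq0.ne']

theorem normLp_sub_rpow_le {p : ℝ} (hp : 1 ≤ p)
    (hmem : ∀ u : H1 N, MemLp (fn u) (ENNReal.ofReal p) volume) {κ : ℝ} {u v : H1 N}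
    (hu : normLp p u ≤ κ) : normLp p (u - v) ^ p ≤ (κ + normLp p v) ^ p := by
  have h1 : normLp p (u - v) ≤ normLp p u + normLp p v := by
    have h2 : normLp p (u - v) = lpNorm (⇑(fn u) - ⇑(fn v)) (ENNReal.ofReal p) volume := by
      rw [normLp_eq_toReal, fn_sub, eLpNorm_congr_ae (Lp.coeFn_sub _ _), lpNorm,
        if_pos ((Lp.aestronglyMeasurable _).sub (Lp.aestronglyMeasurable _))]
    rw [h2]
    exact lpNorm_sub_le (hmem u) (by simpa using hp)
  exact Real.rpow_le_rpow (normLp_nonneg _ _) (h1.trans (by linarith)) (by linarith)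

theorem exists_normLp_le (hN : 3 ≤ N) (hq : 2 < q) (hq' : q < 2 + 4 / N) (M : ℝ) :
    ∃ κ : ℝ, ∀ u : H1 N, normLp 2 u ≤ M → gradNorm u ≤ M →
      normLp q u ≤ κ ∧ normLp (critExp N) u ≤ κ := by
  obtain ⟨κ, hκ0, hκ⟩ := exists_normLp_critExp_le hN
  obtain ⟨hC0, hGN⟩ := gagliardo_nirenberg hN hq hq' le_rfl
  have h3 : (3 : ℝ) ≤ N := by exact_mod_cast hN
  have e2 : (1 - N * (1 / 2 - 1 / q) : ℝ) = alpha1 N q / q := by rw [alpha1]; field_simp; ring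
  have h1 : 0 ≤ (N * (1 / 2 - 1 / q) : ℝ) := by
    have : 1 / q ≤ 1 / 2 := one_div_le_one_div_of_le two_pos hq.le
    exact mul_nonneg (by linarith) (by linarith)
  have h2 : 0 ≤ (1 - N * (1 / 2 - 1 / q) : ℝ) := by
    rw [e2]; exact div_nonneg (alpha1_pos hN hq').le (by linarith)
  refine ⟨max (gnConst N q * M ^ (N * (1 / 2 - 1 / q) : ℝ) * M ^ (1 - N * (1 / 2 - 1 / q) : ℝ))
    (κ * M), fun u hu hg => ⟨le_max_of_le_left ((hGN u).trans ?_),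
      le_max_of_le_right ((hκ u).2.trans ?_)⟩⟩
  · have ha := normLp_nonneg 2 u
    have hb := gradNorm_nonneg u
    have hM : 0 ≤ M := hb.trans hg
    gcongr
  · gcongr

/-- Along weakly and almost everywhere convergent bounded sequences, the mass, the Dirichlet energy
and the full energy split. -/
theorem tendsto_splitting (hN : 3 ≤ N) (hq : 2 < q) (hq' : q < 2 + 4 / N) {M : ℝ} {z : ℕ → H1 N}
    {v : H1 N} (h2 : ∀ n, normLp 2 (z n) ≤ M) (hg : ∀ n, gradNorm (z n) ≤ M)
    (hw2 : ∀ h : L2 N, Tendsto (fun n => inner ℂ h (fn (z n))) atTop (𝓝 (inner ℂ h (fn v))))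
    (hwg : ∀ h : L2Vec N, Tendsto (fun n => inner ℂ h (grad (z n))) atTop
      (𝓝 (inner ℂ h (grad v))))
    (hae : ∀ᵐ x, Tendsto (fun n => fn (z n - v) x) atTop (𝓝 0)) :
    Tendsto (fun n => normLp 2 (z n) ^ 2 - normLp 2 (z n - v) ^ 2) atTop (𝓝 (normLp 2 v ^ 2)) ∧
    Tendsto (fun n => gradNorm (z n) ^ 2 - gradNorm (z n - v) ^ 2) atTop (𝓝 (gradNorm v ^ 2)) ∧
    Tendsto (fun n => energy q μ (z n) - energy q μ (z n - v)) atTop (𝓝 (energy q μ v)) := by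
  have hm := tendsto_norm_sq_sub_of_weak hw2
  have hgr : Tendsto (fun n => gradNorm (z n) ^ 2 - gradNorm (z n - v) ^ 2) atTop
      (𝓝 (gradNorm v ^ 2)) := tendsto_norm_sq_sub_of_weak hwg
  obtain ⟨κ, hκ⟩ := exists_normLp_le hN hq hq' M
  have hc := critExp_gt_two hN
  have hQ := tendsto_normLp_rpow_sub (by linarith : 1 < q) (memLp_subcritical hN hq hq')
    (fun n => normLp_sub_rpow_le (v := v) (by linarith) (memLp_subcritical hN hq hq')
      (hκ (z n) (h2 n) (hg n)).1) hae
  have hR := tendsto_normLp_rpow_sub (by linarith : 1 < critExp N) (memLp_critExp hN)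
    (fun n => normLp_sub_rpow_le (v := v) (by linarith) (memLp_critExp hN)
      (hκ (z n) (h2 n) (hg n)).2) hae
  refine ⟨by simpa only [normLp_two, fn_sub] using hm, hgr, ?_⟩
  refine (((hgr.const_mul (1 / 2)).sub (hQ.const_mul (μ / q))).sub
    (hR.const_mul (1 / critExp N))).congr fun n => ?_
  rw [energy, energy]
  ring

/-- No mass is lost in the weak limit of a minimizing sequence. -/
theorem mass_eq_of_splitting (hN : 3 ≤ N) (hq : 2 < q) (hq' : q < 2 + 4 / N) (hμ : 0 < μ)
    (hC : gnConst N q ≤ C) {c : ℝ} (hc0 : 0 < c) (hc : c < c0 N q μ C) {w : ℕ → H1 N} {v : H1 N}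
    (hv : 0 < normLp 2 v) (hvρ : gradNorm v ^ 2 ≤ rho0 N q μ C)
    (hwρ : ∀ᶠ n in atTop, gradNorm (w n) ^ 2 ≤ rho0 N q μ C)
    (hmass : Tendsto (fun n => normLp 2 (w n) ^ 2) atTop (𝓝 (c - normLp 2 v ^ 2)))
    (hen : Tendsto (fun n => energy q μ (w n)) atTop
      (𝓝 (infEnergy N q μ C c - energy q μ v))) : normLp 2 v ^ 2 = c := by
  have hle : normLp 2 v ^ 2 ≤ c := by
    have := ge_of_tendsto' hmass fun n => sq_nonneg (normLp 2 (w n))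
    linarith
  refine hle.eq_of_not_lt fun hlt => ?_
  -- If mass were lost, `v` would lie strictly above its linear share of `m(c)`, while the
  -- remainders, whose masses are eventually in `(0, c)`, lie at least at theirs; the shares add up
  -- to `m(c)`, a contradiction.
  have h1 := (infEnergy_mul_le hN hq hq' hμ hC hc (by positivity) hle hvρ).2 hlt
  have h2 : (c - normLp 2 v ^ 2) / c * infEnergy N q μ C c
      ≤ infEnergy N q μ C c - energy q μ v := by
    refine le_of_tendsto_of_tendsto ((hmass.div_const c).mul_const _) hen ?_
    filter_upwards [hwρ, hmass.eventually_lt_const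
      (by linarith [sq_pos_of_pos hv] : c - normLp 2 v ^ 2 < c),
      hmass.eventually_const_lt (by linarith : 0 < c - normLp 2 v ^ 2)] with n h3 h4 h5
    exact (infEnergy_mul_le hN hq hq' hμ hC hc h5 h4.le h3).1
  have h3 : (c - normLp 2 v ^ 2) / c * infEnergy N q μ C c
      = infEnergy N q μ C c - normLp 2 v ^ 2 / c * infEnergy N q μ C c := by
    field_simp
  linarith

theorem tendsto_subcritical_term_zero (hN : 3 ≤ N) (hq : 2 < q) (hq' : q < 2 + 4 / N) (hμ : 0 < μ)
    (hC : gnConst N q ≤ C) {w : ℕ → H1 N} {ρ : ℝ}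
    (hwρ : ∀ᶠ n in atTop, gradNorm (w n) ^ 2 ≤ ρ)
    (hmass : Tendsto (fun n => normLp 2 (w n) ^ 2) atTop (𝓝 0)) :
    Tendsto (fun n => μ / q * normLp q (w n) ^ q) atTop (𝓝 0) := by
  have hC0 := (gagliardo_nirenberg hN hq hq' hC).1
  have hA := coefA_pos hq hμ hC0
  have h1 := alpha1_pos hN hq'
  have h0 : 0 ≤ 1 + alpha0 N q / 2 := by
    have h3 : (3 : ℝ) ≤ N := by exact_mod_cast hN
    have : 0 ≤ N * (q - 2) := mul_nonneg (by linarith) (by linarith)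
    rw [alpha0]; linarith
  have hlim : Tendsto (fun n => coefA q μ C * ρ ^ (1 + alpha0 N q / 2)
      * (normLp 2 (w n) ^ 2) ^ (alpha1 N q / 2)) atTop (𝓝 0) := by
    have h2 := (Real.continuousAt_rpow_const 0 (alpha1 N q / 2)
      (Or.inr (by linarith))).tendsto.comp hmass
    rw [Real.zero_rpow (by linarith)] at h2
    simpa using h2.const_mul (coefA q μ C * ρ ^ (1 + alpha0 N q / 2))
  refine tendsto_of_tendsto_of_tendsto_of_le_of_le' tendsto_const_nhds hlim
    (Eventually.of_forall fun n => ?_) ?_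
  · exact mul_nonneg (by positivity) (Real.rpow_nonneg (normLp_nonneg _ _) _)
  · filter_upwards [hwρ] with n hn
    refine (subcritical_term_le hN hq hq' hμ hC (w n)).trans ?_
    gcongr

/-- With the subcritical term gone, coercivity bounds `δ ‖∇w‖²` by the energy up to `o(1)`. A limit
`e ≤ 0` then leaves no room for either the gradient or `e`. -/
theorem tendsto_gradNorm_zero (hN : 3 ≤ N) (hq : 2 < q) (hq' : q < 2 + 4 / N) (hμ : 0 < μ)
    (hC : gnConst N q ≤ C) {w : ℕ → H1 N} {e : ℝ} (he : e ≤ 0)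
    (hwρ : ∀ᶠ n in atTop, gradNorm (w n) ^ 2 ≤ rho0 N q μ C)
    (hmass : Tendsto (fun n => normLp 2 (w n) ^ 2) atTop (𝓝 0))
    (hen : Tendsto (fun n => energy q μ (w n)) atTop (𝓝 e)) :
    Tendsto (fun n => gradNorm (w n) ^ 2) atTop (𝓝 0) ∧ e = 0 := by
  have hC0 := (gagliardo_nirenberg hN hq hq' hC).1
  have hδ := coefB_mul_rho0_lt hN hq hq' hμ hC0
  set δ := 1 / 2 - coefB N * rho0 N q μ C ^ (alpha2 N / 2) with hδ'
  have hδ0 : 0 < δ := by linarith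
  have hsub := tendsto_subcritical_term_zero hN hq hq' hμ hC hwρ hmass
  have hlim := (hen.add hsub).div_const δ
  rw [add_zero] at hlim
  have hbd : ∀ᶠ n in atTop, gradNorm (w n) ^ 2
      ≤ (energy q μ (w n) + μ / q * normLp q (w n) ^ q) / δ := by
    filter_upwards [hwρ] with n hn
    rw [le_div_iff₀ hδ0, mul_comm]
    have h1 := energy_ge (q := q) (μ := μ) hN hn
    rw [← hδ'] at h1
    linarith
  have he0 : 0 ≤ e / δ := ge_of_tendsto hlim (hbd.mono fun n hn => (sq_nonneg _).trans hn)
  have he1 : e = 0 := le_antisymm he (by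
    by_contra hcon
    exact he0.not_gt (div_neg_of_neg_of_pos (not_le.1 hcon) hδ0))
  refine ⟨?_, he1⟩
  rw [he1, zero_div] at hlim
  exact tendsto_of_tendsto_of_tendsto_of_le_of_le' tendsto_const_nhds hlim
    (Eventually.of_forall fun n => sq_nonneg _) hbd

/-- Minimizing sequences are compact up to translation. -/
theorem exists_convergent_translates (hN : 3 ≤ N) (hq : 2 < q) (hq' : q < 2 + 4 / N) (hμ : 0 < μ)
    (hC : gnConst N q ≤ C) {c : ℝ} (hc : c ∈ Ioo 0 (c0 N q μ C)) {u : ℕ → H1 N}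
    (hu : ∀ n, u n ∈ gradBall N (rho0 N q μ C))
    (hmass : Tendsto (fun n => normLp 2 (u n) ^ 2) atTop (𝓝 c))
    (hen : Tendsto (fun n => energy q μ (u n)) atTop (𝓝 (infEnergy N q μ C c))) :
    ∃ k : ℕ → ℕ, StrictMono k ∧ ∃ y : ℕ → Eucl N, ∃ v ∈ minimizers N q μ C c,
      Tendsto (fun n => shift (y n) (u (k n))) atTop (𝓝 v) := by
  obtain ⟨hc0, hc⟩ := hc
  have hC0 := (gagliardo_nirenberg hN hq hq' hC).1
  have hρ := rho0_pos hN hq hq' hμ hC0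
  have hm := infEnergy_neg (C := C) hN hq hq' hμ hC hc0
  set m := infEnergy N q μ C c
  obtain ⟨η, hη, hηev⟩ := energy_eventually_nonvanishing hN hq hq' hμ hC0 hm hu hen
  -- Discarding the first `n₀` terms makes the eventual bounds hold for every index.
  obtain ⟨n₀, hn₀⟩ := eventually_atTop.1
    (hηev.and (hmass.eventually_lt_const (by linarith : c < c + 1)))
  set M := √(c + 1) + √(rho0 N q μ C)
  have hM2 : ∀ n, normLp 2 (u (n + n₀)) ≤ M := fun n => by
    have h1 := Real.le_sqrt_of_sq_le (hn₀ (n + n₀) (Nat.le_add_left _ _)).2.le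
    linarith [Real.sqrt_nonneg (rho0 N q μ C)]
  have hMg : ∀ n, gradNorm (u (n + n₀)) ≤ M := fun n => by
    have h1 := Real.le_sqrt_of_sq_le (le_of_lt (hu (n + n₀)))
    linarith [Real.sqrt_nonneg (c + 1)]
  obtain ⟨k, hk, y, v, hv, hw2, hwg, hae⟩ := exists_translates_weak_limit hN hq hq' hη
    (u := fun n => u (n + n₀)) hM2 hMg fun n => (hn₀ (n + n₀) (Nat.le_add_left _ _)).1
  have hkt : Tendsto (fun n => k n + n₀) atTop atTop :=
    (tendsto_add_atTop_nat n₀).comp hk.tendsto_atTop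
  set z : ℕ → H1 N := fun n => shift (y n) (u (k n + n₀)) with hz
  have hzρ : ∀ n, gradNorm (z n) ^ 2 < rho0 N q μ C := fun n => by
    rw [hz, gradNorm_shift]; exact hu _
  have hzm : Tendsto (fun n => normLp 2 (z n) ^ 2) atTop (𝓝 c) := by
    simp only [hz, normLp_shift]; exact hmass.comp hkt
  have hze : Tendsto (fun n => energy q μ (z n)) atTop (𝓝 m) := by
    simp only [hz, energy_shift]; exact hen.comp hkt
  obtain ⟨hs2, hsg, hse⟩ := tendsto_splitting (μ := μ) hN hq hq' (z := z) (v := v) (M := M)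
    (fun n => by rw [hz, normLp_shift]; exact hM2 _)
    (fun n => by rw [hz, gradNorm_shift]; exact hMg _) hw2 hwg hae
  have hgv := gradNorm_pos_of_mass_pos hN hq hq' hC hv
  have hvρ : gradNorm v ^ 2 ≤ rho0 N q μ C :=
    le_of_tendsto' hsg fun n => by linarith [hzρ n, sq_nonneg (gradNorm (z n - v))]
  -- The gradient norms split and `v` takes a positive share, so the remainders eventually stay in
  -- the ball.
  have hwρ : ∀ᶠ n in atTop, gradNorm (z n - v) ^ 2 ≤ rho0 N q μ C := by
    filter_upwards [hsg.eventually_const_lt (by positivity : 0 < gradNorm v ^ 2)] with n hn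
    linarith [hzρ n]
  have hwm : Tendsto (fun n => normLp 2 (z n - v) ^ 2) atTop (𝓝 (c - normLp 2 v ^ 2)) :=
    (hzm.sub hs2).congr fun n => by ring
  have hwe : Tendsto (fun n => energy q μ (z n - v)) atTop (𝓝 (m - energy q μ v)) :=
    (hze.sub hse).congr fun n => by ring
  have hvc := mass_eq_of_splitting hN hq hq' hμ hC hc0 hc hv hvρ hwρ hwm hwe
  rw [hvc, sub_self] at hwm
  -- At this stage `v` is only in the closed ball, so the comparison lemma replaces the definition
  -- of the infimum. It gives the remainders a limiting energy `m - F_μ(v) ≤ 0`.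
  have hvm : m ≤ energy q μ v := by
    have := (infEnergy_mul_le hN hq hq' hμ hC hc (by positivity) hvc.le hvρ).1
    rwa [hvc, div_self hc0.ne', one_mul] at this
  obtain ⟨hwg0, he0⟩ := tendsto_gradNorm_zero hN hq hq' hμ hC (by linarith) hwρ hwm hwe
  have hve : energy q μ v = m := by linarith
  -- On the boundary sphere the energy at mass `c` would be nonnegative, whereas it equals `m < 0`.
  have hvρ' : gradNorm v ^ 2 < rho0 N q μ C := by
    refine hvρ.lt_of_not_ge fun hge => ?_
    have := energy_nonneg_of_gradNorm hN hq hq' hμ hC hc (by positivity) hvc.le hvρ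
      (by rwa [hvc, div_self hc0.ne', one_mul])
    linarith
  refine ⟨fun n => k n + n₀, fun a b hab => Nat.add_lt_add_right (hk hab) n₀, y, v,
    ⟨⟨hvc, hvρ'⟩, hve⟩, ?_⟩
  rw [tendsto_iff_norm_sub_tendsto_zero]
  have h1 : Tendsto (fun n => ‖z n - v‖ ^ 2) atTop (𝓝 0) := by
    simp only [norm_sq_eq]
    simpa using hwm.add hwg0
  have h2 := (Real.continuous_sqrt.tendsto 0).comp h1
  rw [Real.sqrt_zero] at h2
  exact h2.congr fun n => Real.sqrt_sq (norm_nonneg _)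

theorem nonempty_minimizers (hN : 3 ≤ N) (hq : 2 < q) (hq' : q < 2 + 4 / N) (hμ : 0 < μ)
    (hC : gnConst N q ≤ C) {c : ℝ} (hc : c ∈ Ioo 0 (c0 N q μ C)) :
    (minimizers N q μ C c).Nonempty := by
  have hne : (energy q μ '' localSet N q μ C c).Nonempty := by
    obtain ⟨u, h1, h2, -⟩ := exists_energy_neg hN hq hq' hμ hc.1
      (rho0_pos hN hq hq' hμ (gagliardo_nirenberg hN hq hq' hC).1)
    exact ⟨_, u, ⟨h1, h2⟩, rfl⟩
  obtain ⟨e, -, he, hmem⟩ := exists_seq_tendsto_sInf hne (bddBelow_energy hN hq hq' hμ hC c)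
  choose u hu hue using hmem
  obtain ⟨-, -, -, v, hv, -⟩ := exists_convergent_translates hN hq hq' hμ hC hc (u := u)
    (fun n => (hu n).2) (tendsto_const_nhds.congr fun n => (hu n).1.symm)
    (he.congr fun n => (hue n).symm)
  exact ⟨v, hv⟩

end Minimizers

end MixedNLS

/-- `C` is any admissible constant `C_{N,q}` in the Gagliardo-Nirenberg inequality, that is, any
real number not smaller than the optimal one. -/
theorem theorem2p5 (N : ℕ) (hN : 3 ≤ N) (q : ℝ) (hq : 2 < q) (hq' : q < 2 + 4 / N)
    (μ : ℝ) (hμ : 0 < μ) (C : ℝ) (hC : gnConst N q ≤ C)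
    (c : ℝ) (hc : c ∈ Set.Ioo 0 (c0 N q μ C)) :
    (∀ u : ℕ → H1 N, (∀ n, u n ∈ gradBall N (rho0 N q μ C)) →
      Tendsto (fun n => normLp 2 (u n) ^ 2) atTop (𝓝 c) →
      Tendsto (fun n => energy q μ (u n)) atTop (𝓝 (infEnergy N q μ C c)) →
      ∃ k : ℕ → ℕ, StrictMono k ∧ ∃ y : ℕ → Eucl N, ∃ v ∈ minimizers N q μ C c,
        Tendsto (fun n => shift (y n) (u (k n))) atTop (𝓝 v)) ∧
    (minimizers N q μ C c).Nonempty ∧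
    IsCompactUpToTranslation (minimizers N q μ C c) := by
  refine ⟨fun u hu hm he => exists_convergent_translates hN hq hq' hμ hC hc hu hm he,
    nonempty_minimizers hN hq hq' hμ hC hc, fun u hu => ?_⟩
  exact exists_convergent_translates hN hq hq' hμ hC hc (fun n => (hu n).1.2)
    (tendsto_const_nhds.congr fun n => (hu n).1.1.symm)
    (tendsto_const_nhds.congr fun n => (hu n).2.symm)
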